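/- Let $N\ge 1$, $1<p<\infty$, and let $W^{1,p}_+(\mathbb R^N)$ be the cone of (a.e.) nonnegative functions of $W^{1,p}(\mathbb R^N)$. For a closed half-space $H\subset\mathbb R^N$ let $\sigma_H$ be the reflection in $\partial H$, and for $u:\mathbb R^N\to\mathbb R$ let the polarization $u^H$ be defined by $u^H(x)=\max\{u(x),u(\sigma_H(x))\}$ for $x\in H$ and $u^H(x)=\min\{u(x),u(\sigma_H(x))\}$ for $x\notin H$; write $u^{H_1\cdots H_m}=(\cdots(u^{H_1})^{H_2}\cdots)^{H_m}$. Half-spaces are topologized by their outer unit normals $a$ and offsets $b$, where $H=\{x:\langle a,x\rangle\le b\}$ (equivalently, $H_n\to H$ iff $H_n=i_n(H)$ for isometries $i_n$ converging to the identity). Let $u^*$ be the Schwarz symmetrization of $u$, i.e. the a.e. unique function that is radial and nonincreasing in $|x|$ and satisfies $|\{u^*>t\}|=|\{u>t\}|$ for all $t>0$. Let $\varrho:[0,\infty)\times\mathbb R^N\to\mathbb R$ be Borel measurable and set $$J(u)=\int_{\mathbb R^N}\varrho(u,\nabla u)\,dx\in[-\infty,+\infty]$$ for those $u\in W^{1,p}_+(\mathbb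 R^N)$ for which the integral exists (that is, the positive or the negative part of the integrand has a finite integral). Let $(H_n)_{n\ge1}$ be a sequence of closed half-spaces, each containing $0$ in its interior, that is dense in the set of closed half-spaces containing $0$. Given $u\in W^{1,p}_+(\mathbb R^N)$, put $$u_0=u,\qquad u_{n+1}=u_n^{H_1\cdots H_{n+1}}\quad(n\ge 0),$$ and assume that all the integrals $J(u_n)$ exist and that 1. $-\infty<J(u)<+\infty$; 2. $\liminf_{n} J(u_n)\le J(u)$; 3. if $(u_n)$ converges weakly in $W^{1,p}(\mathbb R^N)$ to some $v\in W^{1,p}_+(\mathbb R^N)$, then $J(v)$ exists and $J(v)\le\liminf_n J(u_n)$. Then $u^*\in W^{1,p}_+(\mathbb R^N)$, the integral $J(u^*)$ exists, and $$J(u^*)\le J(u).$$ -/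

import Mathlib

open MeasureTheory Filter Topology
open scoped ENNReal NNReal ContDiff

noncomputable section

namespace PolyaSzego

/-- The Euclidean space `ℝ^N`. -/
abbrev E (N : ℕ) : Type := EuclideanSpace ℝ (Fin N)

/-! ### Half-spaces, reflections and polarization -/

/-- A closed half-space `{x | ⟪a, x⟫ ≤ b}` of `ℝ^N`, given by its outer unit normal `a` and its
offset `b` (which it determines uniquely). -/
structure HalfSpace (N : ℕ) where
  normal : E N
  offset : ℝ
  norm_normal : ‖normal‖ = 1

/-- The half-space as a set of points. -/
def HalfSpace.carrier {N : ℕ} (H : HalfSpace N) : Set (E N) :=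
  {x | inner ℝ H.normal x ≤ H.offset}

/-- Half-spaces converge when normals and offsets do. Equivalently, `H_n → H` if and only if
`H_n = i_n(H)` for isometries `i_n` of `ℝ^N` that converge to the identity. -/
instance (N : ℕ) : TopologicalSpace (HalfSpace N) :=
  TopologicalSpace.induced (fun H => (H.normal, H.offset)) inferInstance

/-- The reflection `σ_H` in the boundary hyperplane of `H`. -/
def HalfSpace.reflect {N : ℕ} (H : HalfSpace N) (x : E N) : E N :=
  x - (2 * (inner ℝ H.normal x - H.offset)) • H.normal

open Classical in
/-- The polarization (two-point rearrangement) `u^H`. -/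
def polarize {N : ℕ} (H : HalfSpace N) (u : E N → ℝ) : E N → ℝ := fun x =>
  if x ∈ H.carrier then max (u x) (u (H.reflect x)) else min (u x) (u (H.reflect x))

/-- The iterated polarization `u^{H_1 ⋯ H_m} = (⋯(u^{H_1})^{H_2}⋯)^{H_m}`; the sequence
`H_1, H_2, …` is indexed from `0` here, so that `H k` stands for `H_{k+1}`. -/
def polarizeIter {N : ℕ} (H : ℕ → HalfSpace N) (u : E N → ℝ) : ℕ → (E N → ℝ)
  | 0 => u
  | m + 1 => polarize (H m) (polarizeIter H u m)

/-- The sequence `u_0 = u`, `u_{n+1} = u_n^{H_1 ⋯ H_{n+1}}`. -/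
def polarizeSeq {N : ℕ} (H : ℕ → HalfSpace N) (u : E N → ℝ) : ℕ → (E N → ℝ)
  | 0 => u
  | n + 1 => polarizeIter H (polarizeSeq H u n) (n + 1)

/-! ### Schwarz symmetrization -/

/-- The Schwarz symmetrization
`u^*(x) = sup {t ≥ 0 | μ(B(0,|x|)) < μ({u > t})}` (with `sup ∅ = 0`). If `u` is measurable with
`μ({u > t}) < ∞` for all `t > 0`, then away from `x = 0` this is a nonincreasing function of `|x|`
with values in `[0, ∞)`, and `μ({u^* > t}) = μ({u > t})` for all `t > 0`; these properties
determine `u^*` almost everywhere. -/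
def schwarz {N : ℕ} (u : E N → ℝ) : E N → ℝ := fun x =>
  sSup {t : ℝ | 0 ≤ t ∧ volume (Metric.ball (0 : E N) ‖x‖) < volume {y : E N | t < u y}}

/-! ### Sobolev spaces -/

/-- `g` is a weak gradient of `u` on `ℝ^N`: `∫ u ∂ᵢφ = - ∫ gᵢ φ` for all test functions `φ`. -/
structure IsWeakGradient {N : ℕ} (u : E N → ℝ) (g : E N → E N) : Prop where
  locInt : LocallyIntegrable u volume
  locInt_grad : LocallyIntegrable g volume
  parts : ∀ φ : E N → ℝ, ContDiff ℝ ∞ φ → HasCompactSupport φ → ∀ i : Fin N,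
    ∫ x, u x * fderiv ℝ φ x (EuclideanSpace.single i 1) = - ∫ x, g x i * φ x

open Classical in
/-- The weak gradient `∇u` (unique up to null sets), or `0` if there is none. -/
def weakGrad {N : ℕ} (u : E N → ℝ) : E N → E N :=
  if h : ∃ g, IsWeakGradient u g then h.choose else 0

lemma IsWeakGradient.congr {N : ℕ} {u v : E N → ℝ} {g k : E N → E N} (h : IsWeakGradient u g)
    (huv : u =ᵐ[volume] v) (hgk : g =ᵐ[volume] k) : IsWeakGradient v k where
  locInt := h.locInt.congr huv
  locInt_grad := h.locInt_grad.congr hgk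
  parts φ hφ hc i := by
    have h1 : ∫ x, v x * fderiv ℝ φ x (EuclideanSpace.single i 1) =
        ∫ x, u x * fderiv ℝ φ x (EuclideanSpace.single i 1) :=
      integral_congr_ae (huv.mono fun x hx => by simp only [hx])
    have h2 : ∫ x, k x i * φ x = ∫ x, g x i * φ x :=
      integral_congr_ae (hgk.mono fun x hx => by simp only [hx])
    rw [h1, h2]
    exact h.parts φ hφ hc i

lemma integrable_mul_test {N : ℕ} {u ψ : E N → ℝ} (hu : LocallyIntegrable u volume)
    (hψ : Continuous ψ) (hc : HasCompactSupport ψ) : Integrable (fun x => u x * ψ x) volume := by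
  simpa [mul_comm] using hu.integrable_smul_left_of_hasCompactSupport hψ hc

lemma continuous_partial {N : ℕ} {φ : E N → ℝ} (hφ : ContDiff ℝ ∞ φ) (i : Fin N) :
    Continuous fun x => fderiv ℝ φ x (EuclideanSpace.single i 1) :=
  (hφ.continuous_fderiv (by simp)).clm_apply continuous_const

lemma locallyIntegrable_coord {N : ℕ} {g : E N → E N} (hg : LocallyIntegrable g volume)
    (i : Fin N) : LocallyIntegrable (fun x => g x i) volume := fun x => by
  obtain ⟨s, hs, h⟩ := hg x
  exact ⟨s, hs, (EuclideanSpace.proj (𝕜 := ℝ) i).integrable_comp h⟩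

lemma IsWeakGradient.add {N : ℕ} {u v : E N → ℝ} {g k : E N → E N} (h : IsWeakGradient u g)
    (h' : IsWeakGradient v k) : IsWeakGradient (u + v) (g + k) where
  locInt := h.locInt.add h'.locInt
  locInt_grad := h.locInt_grad.add h'.locInt_grad
  parts φ hφ hc i := by
    have hd := continuous_partial hφ i
    have hdc : HasCompactSupport fun x => fderiv ℝ φ x (EuclideanSpace.single i 1) :=
      hc.fderiv_apply ℝ _
    simp only [Pi.add_apply, PiLp.add_apply, add_mul]
    rw [integral_add (integrable_mul_test h.locInt hd hdc) (integrable_mul_test h'.locInt hd hdc),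
      integral_add (integrable_mul_test (locallyIntegrable_coord h.locInt_grad i) hφ.continuous hc)
        (integrable_mul_test (locallyIntegrable_coord h'.locInt_grad i) hφ.continuous hc),
      h.parts φ hφ hc i, h'.parts φ hφ hc i]
    ring

lemma IsWeakGradient.smul {N : ℕ} {u : E N → ℝ} {g : E N → E N} (c : ℝ)
    (h : IsWeakGradient u g) : IsWeakGradient (c • u) (c • g) where
  locInt := h.locInt.smul c
  locInt_grad := h.locInt_grad.smul c
  parts φ hφ hc i := by
    simp only [Pi.smul_apply, PiLp.smul_apply, smul_eq_mul, mul_assoc, integral_const_mul]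
    rw [h.parts φ hφ hc i]
    ring

lemma IsWeakGradient.zero {N : ℕ} : IsWeakGradient (0 : E N → ℝ) 0 where
  locInt := locallyIntegrable_zero
  locInt_grad := locallyIntegrable_zero
  parts φ hφ hc i := by simp

/-- The Sobolev space `W^{1,p}(ℝ^N)`, as the space of the pairs `(u, ∇u)` in `L^p × L^p`. Its norm
`max (‖u‖_p) (‖∇u‖_p)` is equivalent to the usual one. -/
def W1p (N : ℕ) (p : ℝ≥0∞) : Submodule ℝ (Lp ℝ p (volume : Measure (E N)) ×
    Lp (E N) p (volume : Measure (E N))) where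
  carrier := {F | IsWeakGradient F.1 F.2}
  add_mem' {F G} hF hG := (IsWeakGradient.add hF hG).congr
    (Lp.coeFn_add F.1 G.1).symm (Lp.coeFn_add F.2 G.2).symm
  zero_mem' := IsWeakGradient.zero.congr
    (Lp.coeFn_zero _ _ _).symm (Lp.coeFn_zero _ _ _).symm
  smul_mem' c F hF := (IsWeakGradient.smul c hF).congr
    (Lp.coeFn_smul c F.1).symm (Lp.coeFn_smul c F.2).symm

/-- The element `U` of `W^{1,p}(ℝ^N)` is the class of the function `u`. -/
def Represents {N : ℕ} {p : ℝ≥0∞} (U : W1p N p) (u : E N → ℝ) : Prop :=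
  U.1.1 =ᵐ[volume] u

/-- `u ∈ W^{1,p}_+(ℝ^N)`: `u` is a nonnegative function of `W^{1,p}(ℝ^N)`. -/
def MemW1pPos {N : ℕ} (p : ℝ≥0∞) (u : E N → ℝ) : Prop :=
  (∃ U : W1p N p, Represents U u) ∧ 0 ≤ᵐ[volume] u

/-- `us n ⇀ v` weakly in `W^{1,p}(ℝ^N)`: all these functions are in `W^{1,p}(ℝ^N)`, and
`ℓ (us n) → ℓ v` for each continuous linear functional `ℓ` on `W^{1,p}(ℝ^N)`. -/
def WeakTendsto {N : ℕ} (p : ℝ≥0∞) [Fact (1 ≤ p)] (us : ℕ → E N → ℝ) (v : E N → ℝ) : Prop :=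
  ∃ (U : ℕ → W1p N p) (V : W1p N p), (∀ n, Represents (U n) (us n)) ∧ Represents V v ∧
    ∀ ℓ : W1p N p →L[ℝ] ℝ, Tendsto (fun n => ℓ (U n)) atTop (𝓝 (ℓ V))

/-! ### The functional -/

/-- The integral of `f` exists in `[-∞, ∞]`: at least one of `∫ f⁺`, `∫ f⁻` is finite. -/
def IntegralExists {N : ℕ} (f : E N → ℝ) : Prop :=
  ∫⁻ x, ENNReal.ofReal (f x) < ⊤ ∨ ∫⁻ x, ENNReal.ofReal (- f x) < ⊤

/-- The extended integral `∫ f⁺ - ∫ f⁻` in `[-∞, ∞]`; meaningful if `IntegralExists f`. -/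
def extIntegral {N : ℕ} (f : E N → ℝ) : EReal :=
  ((∫⁻ x, ENNReal.ofReal (f x) : ℝ≥0∞) : EReal) - ((∫⁻ x, ENNReal.ofReal (- f x) : ℝ≥0∞) : EReal)

/-- The integrand `x ↦ ϱ(u(x), ∇u(x))`. -/
def integrand {N : ℕ} (ϱ : ℝ≥0 × E N → ℝ) (u : E N → ℝ) : E N → ℝ := fun x =>
  ϱ ((u x).toNNReal, weakGrad u x)

/-- `J(u) = ∫ ϱ(u, ∇u) dx` is well defined in `[-∞, ∞]`. -/
def JExists {N : ℕ} (ϱ : ℝ≥0 × E N → ℝ) (u : E N → ℝ) : Prop :=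
  IntegralExists (integrand ϱ u)

/-- The functional `J(u) = ∫ ϱ(u, ∇u) dx`. -/
def J {N : ℕ} (ϱ : ℝ≥0 × E N → ℝ) (u : E N → ℝ) : EReal :=
  extIntegral (integrand ϱ u)

end PolyaSzego

end

/-!
The integrals over `ϱ` enter only through the last two hypotheses: as soon as the iterated
polarizations `u_n` converge weakly in `W^{1,p}` to `u^*`, lower semicontinuity gives
`J(u^*) ≤ liminf J(u_n) ≤ J(u)`. What has to be shown is that `u^* ∈ W^{1,p}` and `u_n ⇀ u^*`
(`weakTendsto_polarizeSeq`). There are two parts.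

*Strong convergence `u_n → u^*` in `L^p`* (`tendsto_polarizeSeq`). Polarization is nonexpansive in
`L^p` (a two-point inequality, summed over the orbits of the reflection), so by density it suffices
to control continuous functions `f ≥ 0` with compact support. For these, all `f_n` share the modulus
of continuity and a supporting ball of `f`. Limits are taken along ultrafilters, which replaces the
extraction of subsequences. The second moment `∫ f ‖x‖²` strictly decreases under a polarization
that changes `f`, so a limit `v` of the `f_n` is fixed by the polarizations with respect to all the
`H_k`, hence by density of the `H_k` it decreases with `‖x‖`
(`exists_tendsto_polarizeSeq_of_continuous`). For general `u` the limit in `L^p`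
then decreases with `‖x‖` outside a null set, and it has the distribution of `u`; these two
properties characterize `u^*` (`ae_eq_schwarz`).

*Boundedness and weak compactness in `W^{1,p}`*. The norms of `u_n` and `∇u_n` do not increase
(`exists_W1p_polarize`). For Lipschitz functions this is a pointwise comparison of gradients at
`x` and `σ_H(x)`, valid a.e. by Rademacher's theorem; the general case follows by mollification.
Both the passage to the limit there and the final weak convergence rest on
`exists_W1p_of_ae_tendsto`: a bounded sequence in `W^{1,p}` that converges a.e. has its limit in the
closed convex hulls of all its tails. Instead of the duality of the spaces `L^p`, this uses that
nested bounded closed convex sets in a uniformly convex space have a common point.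
-/

noncomputable section

namespace PolyaSzego

/-! ### Reflections -/

lemma HalfSpace.mem_carrier {N : ℕ} (H : HalfSpace N) (x : E N) :
    x ∈ H.carrier ↔ inner ℝ H.normal x ≤ H.offset := Iff.rfl

lemma HalfSpace.reflect_eq {N : ℕ} (H : HalfSpace N) (x : E N) :
    H.reflect x = (ℝ ∙ H.normal)ᗮ.reflection x + (2 * H.offset) • H.normal := by
  rw [Submodule.reflection_orthogonal_apply, Submodule.reflection_singleton_apply,
    HalfSpace.reflect]
  simp only [H.norm_normal]
  simp
  module

lemma HalfSpace.inner_reflect {N : ℕ} (H : HalfSpace N) (x : E N) :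
    inner ℝ H.normal (H.reflect x) = 2 * H.offset - inner ℝ H.normal x := by
  rw [HalfSpace.reflect, inner_sub_right, inner_smul_right, real_inner_self_eq_norm_sq,
    H.norm_normal]
  ring

@[simp]
lemma HalfSpace.reflect_reflect {N : ℕ} (H : HalfSpace N) (x : E N) :
    H.reflect (H.reflect x) = x := by
  conv_lhs => rw [HalfSpace.reflect, H.inner_reflect]
  rw [HalfSpace.reflect]
  module

lemma HalfSpace.reflect_eq_self {N : ℕ} (H : HalfSpace N) {x : E N}
    (hx : inner ℝ H.normal x = H.offset) : H.reflect x = x := by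
  simp [HalfSpace.reflect, hx]

lemma HalfSpace.dist_reflect {N : ℕ} (H : HalfSpace N) (x y : E N) :
    dist (H.reflect x) (H.reflect y) = dist x y := by
  rw [H.reflect_eq, H.reflect_eq, dist_add_right, LinearIsometryEquiv.dist_map]

lemma HalfSpace.continuous_reflect {N : ℕ} (H : HalfSpace N) : Continuous H.reflect :=
  (Isometry.of_dist_eq H.dist_reflect).continuous

lemma HalfSpace.measurePreserving_reflect {N : ℕ} (H : HalfSpace N) :
    MeasurePreserving H.reflect (volume : Measure (E N)) volume := by
  have h : H.reflect = (fun x => x + (2 * H.offset) • H.normal) ∘ (ℝ ∙ H.normal)ᗮ.reflection := by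
    ext1 x
    exact H.reflect_eq x
  rw [h]
  exact (measurePreserving_add_right _ _).comp
    (LinearIsometryEquiv.measurePreserving _)

lemma HalfSpace.norm_sq_reflect {N : ℕ} (H : HalfSpace N) (x : E N) :
    ‖H.reflect x‖ ^ 2 = ‖x‖ ^ 2 - 4 * (inner ℝ H.normal x - H.offset) * H.offset := by
  rw [HalfSpace.reflect, norm_sub_sq_real, inner_smul_right, norm_smul, H.norm_normal,
    real_inner_comm, mul_one, Real.norm_eq_abs, sq_abs]
  ring

lemma HalfSpace.offset_pos {N : ℕ} (H : HalfSpace N) (h : (0 : E N) ∈ interior H.carrier) :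
    0 < H.offset := by
  rw [mem_interior_iff_mem_nhds, Metric.mem_nhds_iff] at h
  obtain ⟨ε, hε, h⟩ := h
  have h1 : (ε / 2) • H.normal ∈ H.carrier := by
    apply h
    rw [mem_ball_zero_iff, norm_smul, H.norm_normal, Real.norm_of_nonneg (by positivity)]
    linarith
  rw [H.mem_carrier, inner_smul_right, real_inner_self_eq_norm_sq, H.norm_normal] at h1
  linarith

/-- Reflection is a measure-preserving involution, so integrals may be compared after summing
the integrands over the pairs `{x, σ_H x}`. -/
lemma HalfSpace.lintegral_le_of_add_reflect_le {N : ℕ} (H : HalfSpace N) {F G : E N → ℝ≥0∞}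
    (hF : AEMeasurable F volume) (hG : AEMeasurable G volume)
    (h : ∀ᵐ x, F x + F (H.reflect x) ≤ G x + G (H.reflect x)) : ∫⁻ x, F x ≤ ∫⁻ x, G x := by
  have key : ∀ {K : E N → ℝ≥0∞}, AEMeasurable K volume →
      ∫⁻ x, (K x + K (H.reflect x)) = 2 * ∫⁻ x, K x := by
    intro K hK
    have h1 : ∫⁻ x, K (H.reflect x) = ∫⁻ x, K x := by
      have := lintegral_map' (μ := volume) (f := K) (g := H.reflect)
        (by rwa [H.measurePreserving_reflect.map_eq]) H.continuous_reflect.measurable.aemeasurable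
      rw [← this, H.measurePreserving_reflect.map_eq]
    rw [lintegral_add_left' hK, h1, two_mul]
  have h2 := lintegral_mono_ae h
  rw [key hF, key hG] at h2
  exact (ENNReal.mul_le_mul_iff_right (by simp) (by simp)).1 h2

/-! ### Elementary properties of polarization -/

section polarize

variable {N : ℕ} (H : HalfSpace N)

lemma polarize_of_le {u : E N → ℝ} {x : E N} (hx : inner ℝ H.normal x ≤ H.offset) :
    polarize H u x = max (u x) (u (H.reflect x)) := by
  rw [polarize, if_pos ((H.mem_carrier x).2 hx)]

lemma polarize_of_ge {u : E N → ℝ} {x : E N} (hx : H.offset ≤ inner ℝ H.normal x) :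
    polarize H u x = min (u x) (u (H.reflect x)) := by
  rcases hx.eq_or_lt with h | h
  · rw [polarize_of_le H h.ge, H.reflect_eq_self h.symm, max_self, min_self]
  · rw [polarize, if_neg (fun h' => absurd ((H.mem_carrier x).1 h') (not_le.2 h))]

lemma polarize_reflect_of_le {u : E N → ℝ} {x : E N} (hx : inner ℝ H.normal x ≤ H.offset) :
    polarize H u (H.reflect x) = min (u x) (u (H.reflect x)) := by
  rw [polarize_of_ge H (by rw [H.inner_reflect]; linarith), H.reflect_reflect, min_comm]

lemma polarize_reflect_of_ge {u : E N → ℝ} {x : E N} (hx : H.offset ≤ inner ℝ H.normal x) :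
    polarize H u (H.reflect x) = max (u x) (u (H.reflect x)) := by
  rw [polarize_of_le H (by rw [H.inner_reflect]; linarith), H.reflect_reflect, max_comm]

lemma polarize_eq_or (u : E N → ℝ) (x : E N) :
    polarize H u x = u x ∨ polarize H u x = u (H.reflect x) := by
  rcases le_total (inner ℝ H.normal x) H.offset with h | h
  · rw [polarize_of_le H h]
    exact max_choice _ _
  · rw [polarize_of_ge H h]
    exact min_choice _ _

lemma polarize_congr_ae {u v : E N → ℝ} (h : u =ᵐ[volume] v) :
    polarize H u =ᵐ[volume] polarize H v := by
  filter_upwards [h, H.measurePreserving_reflect.quasiMeasurePreserving.ae_eq_comp h]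
    with x h1 h2
  simp only [Function.comp_apply] at h2
  simp only [polarize, h1, h2]

lemma measurableSet_carrier : MeasurableSet H.carrier := by
  have : IsClosed H.carrier := isClosed_le (by fun_prop) continuous_const
  exact this.measurableSet

lemma aemeasurable_polarize {u : E N → ℝ} (hu : AEMeasurable u volume) :
    AEMeasurable (polarize H u) volume := by
  have h : Measurable (polarize H (hu.mk u)) := by
    have h1 := hu.measurable_mk.comp H.continuous_reflect.measurable
    exact Measurable.ite (measurableSet_carrier H) (hu.measurable_mk.sup h1)
      (hu.measurable_mk.inf h1)
  exact ⟨_, h, polarize_congr_ae H hu.ae_eq_mk⟩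

/-- Two-point inequality behind the nonexpansivity of polarization: when the two pairs are not
ordered alike, this is convexity of `φ` on the segment from `a - c` to `b - d`. -/
lemma convex_max_sub_max_add_min_sub_min_le {φ : ℝ → ℝ} (hφ : ConvexOn ℝ Set.univ φ)
    (a b c d : ℝ) :
    φ (max a b - max c d) + φ (min a b - min c d) ≤ φ (a - c) + φ (b - d) := by
  have key : ∀ s t α : ℝ, 0 ≤ α → s + α ≤ t → φ (s + α) + φ (t - α) ≤ φ s + φ t := by
    intro s t α hα h
    rcases (show s ≤ t by linarith).eq_or_lt with h1 | h1
    · have : α = 0 := by linarith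
      simp [this]
    have hts : 0 < t - s := by linarith
    have e1 : (1 - α / (t - s)) • s + (α / (t - s)) • t = s + α := by
      simp only [smul_eq_mul]; field_simp; ring
    have e2 : (α / (t - s)) • s + (1 - α / (t - s)) • t = t - α := by
      simp only [smul_eq_mul]; field_simp; ring
    have hle : α / (t - s) ≤ 1 := (div_le_one hts).2 (by linarith)
    have hge : 0 ≤ α / (t - s) := by positivity
    have h3 := hφ.2 (Set.mem_univ s) (Set.mem_univ t) (sub_nonneg.2 hle) hge (by ring)
    have h4 := hφ.2 (Set.mem_univ s) (Set.mem_univ t) hge (sub_nonneg.2 hle) (by ring)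
    rw [e1] at h3
    rw [e2] at h4
    simp only [smul_eq_mul] at h3 h4
    nlinarith
  rcases le_total a b with h1 | h1 <;> rcases le_total c d with h2 | h2
  · rw [max_eq_right h1, max_eq_right h2, min_eq_left h1, min_eq_left h2, add_comm]
  · rw [max_eq_right h1, max_eq_left h2, min_eq_left h1, min_eq_right h2]
    have := key (a - c) (b - d) (b - a) (by linarith) (by linarith)
    convert! this using 3 <;> ring
  · rw [max_eq_left h1, max_eq_right h2, min_eq_right h1, min_eq_left h2]
    have := key (b - d) (a - c) (a - b) (by linarith) (by linarith)
    rw [add_comm (φ (a - c))]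
    convert! this using 3 <;> ring
  · rw [max_eq_left h1, max_eq_left h2, min_eq_right h1, min_eq_right h2]

lemma convexOn_abs_rpow {r : ℝ} (hr : 1 ≤ r) : ConvexOn ℝ Set.univ fun x : ℝ => |x| ^ r := by
  have h1 : ConvexOn ℝ Set.univ fun x : ℝ => |x| := convexOn_univ_norm
  refine ⟨convex_univ, fun x _ y _ a b ha hb hab => ?_⟩
  refine (Real.rpow_le_rpow (abs_nonneg _) (h1.2 (Set.mem_univ x) (Set.mem_univ y) ha hb hab)
    (by linarith)).trans ?_
  exact (convexOn_rpow hr).2 (abs_nonneg x) (abs_nonneg y) ha hb hab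

lemma enorm_rpow_eq_ofReal {r : ℝ} (hr : 0 ≤ r) (x : ℝ) :
    ‖x‖ₑ ^ r = ENNReal.ofReal (|x| ^ r) := by
  rw [← ofReal_norm, Real.norm_eq_abs, ENNReal.ofReal_rpow_of_nonneg (abs_nonneg x) hr]

lemma eLpNorm_le_of_lintegral_le {F G : Type*} [NormedAddCommGroup F] [NormedAddCommGroup G]
    {p : ℝ≥0∞} (hp1 : 1 ≤ p) (hp : p ≠ ⊤) {f : E N → F} {g : E N → G}
    (h : ∫⁻ x, ‖f x‖ₑ ^ p.toReal ≤ ∫⁻ x, ‖g x‖ₑ ^ p.toReal) :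
    eLpNorm f p volume ≤ eLpNorm g p volume := by
  have h0 : p ≠ 0 := (zero_lt_one.trans_le hp1).ne'
  rw [eLpNorm_eq_lintegral_rpow_enorm_toReal h0 hp, eLpNorm_eq_lintegral_rpow_enorm_toReal h0 hp]
  gcongr

/-- Polarization is nonexpansive in `L^p`. -/
lemma eLpNorm_polarize_sub_le {p : ℝ≥0∞} (hp1 : 1 ≤ p) (hp : p ≠ ⊤) {u v : E N → ℝ}
    (hu : AEMeasurable u volume) (hv : AEMeasurable v volume) :
    eLpNorm (polarize H u - polarize H v) p volume ≤ eLpNorm (u - v) p volume := by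
  have hr : 1 ≤ p.toReal := by
    simpa using ENNReal.toReal_mono hp hp1
  refine eLpNorm_le_of_lintegral_le hp1 hp ?_
  refine H.lintegral_le_of_add_reflect_le
    (((aemeasurable_polarize H hu).sub (aemeasurable_polarize H hv)).enorm.pow_const _)
    ((hu.sub hv).enorm.pow_const _) (.of_forall fun x => ?_)
  simp only [Pi.sub_apply, enorm_rpow_eq_ofReal (zero_le_one.trans hr)]
  rw [← ENNReal.ofReal_add (by positivity) (by positivity),
    ← ENNReal.ofReal_add (by positivity) (by positivity)]
  refine ENNReal.ofReal_le_ofReal ?_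
  have := convex_max_sub_max_add_min_sub_min_le (convexOn_abs_rpow hr)
    (u x) (u (H.reflect x)) (v x) (v (H.reflect x))
  rcases le_total (inner ℝ H.normal x) H.offset with h | h
  · rwa [polarize_of_le H h, polarize_of_le H h, polarize_reflect_of_le H h,
      polarize_reflect_of_le H h]
  · rwa [polarize_of_ge H h, polarize_of_ge H h, polarize_reflect_of_ge H h,
      polarize_reflect_of_ge H h, add_comm]

lemma polarize_zero : polarize H (0 : E N → ℝ) = 0 := by
  ext x
  simp [polarize]

lemma memLp_polarize {p : ℝ≥0∞} (hp1 : 1 ≤ p) (hp : p ≠ ⊤) {u : E N → ℝ}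
    (hu : MemLp u p volume) : MemLp (polarize H u) p volume := by
  refine ⟨(aemeasurable_polarize H hu.1.aemeasurable).aestronglyMeasurable, ?_⟩
  have := eLpNorm_polarize_sub_le H hp1 hp hu.1.aemeasurable
    (v := 0) measurable_zero.aemeasurable
  rw [polarize_zero, sub_zero, sub_zero] at this
  exact this.trans_lt hu.2

/-- Polarization preserves the measure of the superlevel sets. -/
lemma volume_lt_polarize {u : E N → ℝ} (hu : AEMeasurable u volume) (t : ℝ) :
    volume {x | t < polarize H u x} = volume {x | t < u x} := by
  have hind : ∀ {w : E N → ℝ}, AEMeasurable w volume →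
      volume {x | t < w x} = ∫⁻ x, (Set.Ioi t).indicator 1 (w x) := by
    intro w hw
    have h0 : NullMeasurableSet {x | t < w x} volume :=
      hw.nullMeasurableSet_preimage measurableSet_Ioi
    rw [← lintegral_indicator_one₀ h0]
    rfl
  have hm : ∀ {w : E N → ℝ}, AEMeasurable w volume →
      AEMeasurable (fun x => (Set.Ioi t).indicator (1 : ℝ → ℝ≥0∞) (w x)) volume := fun hw =>
    (measurable_one.indicator measurableSet_Ioi).comp_aemeasurable hw
  have hP := aemeasurable_polarize H hu
  have key : ∀ x, (Set.Ioi t).indicator (1 : ℝ → ℝ≥0∞) (polarize H u x) +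
      (Set.Ioi t).indicator 1 (polarize H u (H.reflect x)) =
      (Set.Ioi t).indicator 1 (u x) + (Set.Ioi t).indicator 1 (u (H.reflect x)) := by
    intro x
    rcases le_total (inner ℝ H.normal x) H.offset with h | h
    · rw [polarize_of_le H h, polarize_reflect_of_le H h]
      rcases le_total (u x) (u (H.reflect x)) with h' | h' <;> simp [h', add_comm]
    · rw [polarize_of_ge H h, polarize_reflect_of_ge H h]
      rcases le_total (u x) (u (H.reflect x)) with h' | h' <;> simp [h', add_comm]
  rw [hind hu, hind hP]
  exact le_antisymm
    (H.lintegral_le_of_add_reflect_le (hm hP) (hm hu) (.of_forall fun x => (key x).le))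
    (H.lintegral_le_of_add_reflect_le (hm hu) (hm hP) (.of_forall fun x => (key x).ge))

end polarize

/-! ### Properties inherited by iterated polarizations -/

/-- A property preserved by the polarizations with respect to the half-spaces `H k` passes to all
the functions `u_n`. -/
lemma polarizeIter_induction {N : ℕ} {H : ℕ → HalfSpace N} {P : (E N → ℝ) → Prop}
    (h : ∀ k w, P w → P (polarize (H k) w)) {u : E N → ℝ} (hu : P u) (m : ℕ) :
    P (polarizeIter H u m) := by
  induction m with
  | zero => exact hu
  | succ m ih => exact h m _ ih

lemma polarizeSeq_induction {N : ℕ} {H : ℕ → HalfSpace N} {P : (E N → ℝ) → Prop}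
    (h : ∀ k w, P w → P (polarize (H k) w)) {u : E N → ℝ} (hu : P u) (n : ℕ) :
    P (polarizeSeq H u n) := by
  induction n with
  | zero => exact hu
  | succ n ih => exact polarizeIter_induction h ih _

lemma polarizeIter_induction₂ {N : ℕ} {H : ℕ → HalfSpace N} {P : (E N → ℝ) → (E N → ℝ) → Prop}
    (h : ∀ k w z, P w z → P (polarize (H k) w) (polarize (H k) z)) {u v : E N → ℝ} (hu : P u v)
    (m : ℕ) : P (polarizeIter H u m) (polarizeIter H v m) := by
  induction m with
  | zero => exact hu
  | succ m ih => exact h m _ _ ih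

lemma polarizeSeq_induction₂ {N : ℕ} {H : ℕ → HalfSpace N} {P : (E N → ℝ) → (E N → ℝ) → Prop}
    (h : ∀ k w z, P w z → P (polarize (H k) w) (polarize (H k) z)) {u v : E N → ℝ} (hu : P u v)
    (n : ℕ) : P (polarizeSeq H u n) (polarizeSeq H v n) := by
  induction n with
  | zero => exact hu
  | succ n ih => exact polarizeIter_induction₂ h ih _

/-! ### Polarization of continuous functions with compact support -/

/-- `g` is nonnegative, vanishes outside the ball of radius `R`, and satisfies the upper bounds and
moduli of continuity that `f` does. This class is compact and stable under the polarizations with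
respect to half-spaces that contain `0`. -/
structure InheritsFrom {N : ℕ} (f : E N → ℝ) (R : ℝ) (g : E N → ℝ) : Prop where
  nonneg : ∀ x, 0 ≤ g x
  eq_zero : ∀ x, R < ‖x‖ → g x = 0
  le : ∀ M, (∀ x, f x ≤ M) → ∀ x, g x ≤ M
  modulus : ∀ δ ε, (∀ x y, dist x y ≤ δ → |f x - f y| ≤ ε) → ∀ x y, dist x y ≤ δ → |g x - g y| ≤ ε

lemma HalfSpace.dist_reflect_right_le {N : ℕ} (H : HalfSpace N) {x y : E N}
    (hx : inner ℝ H.normal x ≤ H.offset) (hy : H.offset ≤ inner ℝ H.normal y) :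
    dist x (H.reflect y) ≤ dist x y := by
  rw [dist_eq_norm, dist_eq_norm]
  refine le_of_sq_le_sq ?_ (norm_nonneg _)
  have e : x - H.reflect y = (x - y) + (2 * (inner ℝ H.normal y - H.offset)) • H.normal := by
    rw [HalfSpace.reflect]; module
  rw [e, norm_add_sq_real, inner_smul_right, norm_smul, H.norm_normal,
    inner_sub_left, mul_one, Real.norm_eq_abs, sq_abs, real_inner_comm H.normal x,
    real_inner_comm H.normal y]
  nlinarith [mul_nonneg (sub_nonneg.2 hx) (sub_nonneg.2 hy)]

lemma abs_max_sub_max_le {a b c d ε : ℝ} (h1 : |a - c| ≤ ε) (h2 : |b - d| ≤ ε) :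
    |max a b - max c d| ≤ ε :=
  (abs_max_sub_max_le_max a b c d).trans (max_le h1 h2)

lemma abs_min_sub_min_le {a b c d ε : ℝ} (h1 : |a - c| ≤ ε) (h2 : |b - d| ≤ ε) :
    |min a b - min c d| ≤ ε :=
  (abs_min_sub_min_le_max a b c d).trans (max_le h1 h2)

/-- Polarization preserves moduli of continuity. -/
lemma polarize_modulus {N : ℕ} (H : HalfSpace N) {f : E N → ℝ} {δ ε : ℝ}
    (hf : ∀ x y, dist x y ≤ δ → |f x - f y| ≤ ε) (x y : E N) (hxy : dist x y ≤ δ) :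
    |polarize H f x - polarize H f y| ≤ ε := by
  have hr : dist (H.reflect x) (H.reflect y) ≤ δ := by rwa [H.dist_reflect]
  -- If `x` and `y` lie on opposite sides, all four distances between the points of the
  -- two orbits are at most `dist x y`.
  have opp : ∀ x y : E N, dist x y ≤ δ → inner ℝ H.normal x ≤ H.offset →
      H.offset ≤ inner ℝ H.normal y → |polarize H f x - polarize H f y| ≤ ε := by
    intro x y hxy hx hy
    have h1 : dist x (H.reflect y) ≤ δ := (H.dist_reflect_right_le hx hy).trans hxy
    have h2 : dist (H.reflect x) y ≤ δ := by
      rw [← H.dist_reflect, H.reflect_reflect]; exact h1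
    have hr : dist (H.reflect x) (H.reflect y) ≤ δ := by rwa [H.dist_reflect]
    rcases polarize_eq_or H f x with h | h <;> rcases polarize_eq_or H f y with h' | h' <;>
      rw [h, h']
    exacts [hf _ _ hxy, hf _ _ h1, hf _ _ h2, hf _ _ hr]
  rcases le_total (inner ℝ H.normal x) H.offset with hx | hx <;>
    rcases le_total (inner ℝ H.normal y) H.offset with hy | hy
  · rw [polarize_of_le H hx, polarize_of_le H hy]
    exact abs_max_sub_max_le (hf _ _ hxy) (hf _ _ hr)
  · exact opp x y hxy hx hy
  · rw [abs_sub_comm]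
    exact opp y x (by rwa [dist_comm]) hy hx
  · rw [polarize_of_ge H hx, polarize_of_ge H hy]
    exact abs_min_sub_min_le (hf _ _ hxy) (hf _ _ hr)

lemma abs_polarize_sub_le {N : ℕ} (H : HalfSpace N) {f g : E N → ℝ} {ε : ℝ}
    (h : ∀ x, |f x - g x| ≤ ε) (x : E N) : |polarize H f x - polarize H g x| ≤ ε := by
  rcases le_total (inner ℝ H.normal x) H.offset with hx | hx
  · rw [polarize_of_le H hx, polarize_of_le H hx]
    exact abs_max_sub_max_le (h _) (h _)
  · rw [polarize_of_ge H hx, polarize_of_ge H hx]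
    exact abs_min_sub_min_le (h _) (h _)

namespace InheritsFrom

variable {N : ℕ} {f g h : E N → ℝ} {R : ℝ}

lemma polarize (H : HalfSpace N) (hH : 0 ≤ H.offset) (hg : InheritsFrom f R g) :
    InheritsFrom f R (polarize H g) where
  nonneg x := by
    rcases polarize_eq_or H g x with h | h <;> rw [h] <;> exact hg.nonneg _
  eq_zero x hx := by
    rcases le_total (inner ℝ H.normal x) H.offset with h | h
    · have : R < ‖H.reflect x‖ := by
        refine hx.trans_le (le_of_sq_le_sq ?_ (norm_nonneg _))
        rw [H.norm_sq_reflect]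
        nlinarith
      rw [polarize_of_le H h, hg.eq_zero x hx, hg.eq_zero _ this, max_self]
    · rw [polarize_of_ge H h, hg.eq_zero x hx, min_eq_left (hg.nonneg _)]
  le M hM x := by
    rcases polarize_eq_or H g x with h | h <;> rw [h] <;> exact hg.le M hM _
  modulus δ ε hf := polarize_modulus H (hg.modulus δ ε hf)

lemma uniform (hf : UniformContinuous f) {ε : ℝ} (hε : 0 < ε) :
    ∃ δ > 0, ∀ g, InheritsFrom f R g → ∀ x y, dist x y ≤ δ → |g x - g y| ≤ ε := by
  obtain ⟨δ, hδ, h⟩ := Metric.uniformContinuous_iff.1 hf ε hε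
  refine ⟨δ / 2, by positivity, fun g hg => hg.modulus _ _ fun x y hxy => ?_⟩
  exact (h (lt_of_le_of_lt hxy (by linarith))).le

lemma continuous (hf : UniformContinuous f) (hg : InheritsFrom f R g) : Continuous g := by
  refine Metric.continuous_iff.2 fun x ε hε => ?_
  obtain ⟨δ, hδ, h⟩ := uniform (R := R) hf (half_pos hε)
  exact ⟨δ, hδ, fun y hy => lt_of_le_of_lt (h g hg y x hy.le) (by linarith)⟩

lemma hasCompactSupport (hg : InheritsFrom f R g) : HasCompactSupport g :=
  HasCompactSupport.intro (isCompact_closedBall (0 : E N) R) fun x hx => hg.eq_zero x (by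
    simpa using hx)

lemma integrable_mul_normSq (hf : UniformContinuous f) (hg : InheritsFrom f R g) :
    Integrable fun x => g x * ‖x‖ ^ 2 :=
  ((hg.continuous hf).mul (continuous_norm.pow 2)).integrable_of_hasCompactSupport
    hg.hasCompactSupport.mul_right

lemma abs_integral_sub_le (hf : UniformContinuous f) (hg : InheritsFrom f R g)
    (hh : InheritsFrom f R h) {ε : ℝ} (hgh : ∀ x, |g x - h x| ≤ ε) :
    |(∫ x, g x * ‖x‖ ^ 2) - ∫ x, h x * ‖x‖ ^ 2| ≤
      ε * ∫ x in Metric.closedBall (0 : E N) R, ‖x‖ ^ 2 := by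
  rw [← integral_sub (hg.integrable_mul_normSq hf) (hh.integrable_mul_normSq hf),
    ← integral_const_mul, ← integral_indicator Metric.isClosed_closedBall.measurableSet,
    ← Real.norm_eq_abs]
  refine norm_integral_le_of_norm_le ?_ (.of_forall fun x => ?_)
  · rw [integrable_indicator_iff Metric.isClosed_closedBall.measurableSet]
    exact ContinuousOn.integrableOn_compact (isCompact_closedBall _ _) (by fun_prop)
  · by_cases hx : x ∈ Metric.closedBall (0 : E N) R
    · rw [Set.indicator_of_mem hx, ← sub_mul, norm_mul, Real.norm_eq_abs, Real.norm_eq_abs,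
        abs_of_nonneg (sq_nonneg ‖x‖)]
      exact mul_le_mul_of_nonneg_right (hgh x) (sq_nonneg _)
    · rw [Set.indicator_of_notMem hx]
      have hx' : R < ‖x‖ := by simpa using hx
      simp [hg.eq_zero x hx', hh.eq_zero x hx']

lemma eLpNorm_sub_le (hg : InheritsFrom f R g)
    (hh : InheritsFrom f R h) {ε : ℝ≥0} (hgh : ∀ x, |g x - h x| ≤ ε) (p : ℝ≥0∞) :
    eLpNorm (g - h) p volume ≤
      volume (Metric.closedBall (0 : E N) R) ^ p.toReal⁻¹ * ε := by
  have h1 : g - h = (Metric.closedBall (0 : E N) R).indicator (g - h) := by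
    refine (Set.indicator_eq_self.2 fun x hx => ?_).symm
    by_contra hx'
    have hx' : R < ‖x‖ := by simpa using hx'
    exact hx (by simp [hg.eq_zero x hx', hh.eq_zero x hx'])
  rw [h1, eLpNorm_indicator_eq_eLpNorm_restrict Metric.isClosed_closedBall.measurableSet]
  have := eLpNorm_le_of_ae_bound (p := p) (μ := volume.restrict (Metric.closedBall (0 : E N) R))
    (f := g - h) (C := ε) (.of_forall fun x => hgh x)
  simpa using this

/-- Polarization with respect to a half-space containing `0` in its interior decreases the second
moment, strictly unless it leaves the function unchanged. -/
lemma integral_polarize_le (hf : UniformContinuous f) (hg : InheritsFrom f R g) (H : HalfSpace N)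
    (hH : 0 < H.offset) :
    ∫ x, PolyaSzego.polarize H g x * ‖x‖ ^ 2 ≤ ∫ x, g x * ‖x‖ ^ 2 ∧
    (∫ x, PolyaSzego.polarize H g x * ‖x‖ ^ 2 = ∫ x, g x * ‖x‖ ^ 2 →
      PolyaSzego.polarize H g = g) := by
  have hP := hg.polarize H hH.le
  set K : E N → ℝ := fun x => (PolyaSzego.polarize H g x - g x) * ‖x‖ ^ 2
  set L : E N → ℝ := fun x =>
    (g x - PolyaSzego.polarize H g x) * (4 * (inner ℝ H.normal x - H.offset) * H.offset)
  have hKi : Integrable K volume := by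
    simp only [K, sub_mul]
    exact (hP.integrable_mul_normSq hf).sub (hg.integrable_mul_normSq hf)
  have hKr : Integrable (fun x => K (H.reflect x)) volume :=
    H.measurePreserving_reflect.integrable_comp_of_integrable hKi
  have hKL : ∀ x, K x + K (H.reflect x) = - L x := by
    intro x
    have h1 : PolyaSzego.polarize H g (H.reflect x) - g (H.reflect x) =
        g x - PolyaSzego.polarize H g x := by
      rcases le_total (inner ℝ H.normal x) H.offset with hx | hx
      · rw [polarize_of_le H hx, polarize_reflect_of_le H hx]
        linarith [max_add_min (g x) (g (H.reflect x))]
      · rw [polarize_of_ge H hx, polarize_reflect_of_ge H hx]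
        linarith [max_add_min (g x) (g (H.reflect x))]
    simp only [K, L]
    rw [h1, H.norm_sq_reflect]
    ring
  have hLi : Integrable L volume := by
    have := (hKi.add hKr).neg
    refine this.congr (.of_forall fun x => ?_)
    simp only [Pi.neg_apply, Pi.add_apply, hKL, neg_neg]
  have hemb : MeasurableEmbedding H.reflect :=
    (Homeomorph.mk ⟨H.reflect, H.reflect, H.reflect_reflect, H.reflect_reflect⟩
      H.continuous_reflect H.continuous_reflect).measurableEmbedding
  have hint : 2 * ∫ x, K x = - ∫ x, L x := by
    have h1 : ∫ x, K (H.reflect x) = ∫ x, K x :=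
      H.measurePreserving_reflect.integral_comp hemb K
    rw [← integral_neg, ← funext hKL, integral_add hKi hKr, h1, two_mul]
  have hKe : ∫ x, K x = (∫ x, PolyaSzego.polarize H g x * ‖x‖ ^ 2) - ∫ x, g x * ‖x‖ ^ 2 := by
    rw [← integral_sub (hP.integrable_mul_normSq hf) (hg.integrable_mul_normSq hf)]
    simp only [K, sub_mul]
  have hL0 : ∀ x, 0 ≤ L x := by
    intro x
    rcases le_total (inner ℝ H.normal x) H.offset with hx | hx
    · have := le_max_left (g x) (g (H.reflect x))
      simp only [L]
      rw [polarize_of_le H hx]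
      nlinarith [mul_nonneg (mul_nonneg (sub_nonneg.2 this) (sub_nonneg.2 hx)) hH.le]
    · have := min_le_left (g x) (g (H.reflect x))
      simp only [L]
      rw [polarize_of_ge H hx]
      nlinarith [mul_nonneg (mul_nonneg (sub_nonneg.2 this) (sub_nonneg.2 hx)) hH.le]
  refine ⟨by linarith [integral_nonneg (f := L) (μ := volume) hL0], fun heq => ?_⟩
  have h0 : ∫ x, L x = 0 := by linarith
  rw [integral_eq_zero_iff_of_nonneg hL0 hLi] at h0
  have hLc : Continuous L :=
    ((hg.continuous hf).sub (hP.continuous hf)).mul (by fun_prop)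
  have h1 := (hLc.ae_eq_iff_eq volume continuous_zero).1 h0
  ext x
  by_cases hx : inner ℝ H.normal x = H.offset
  · rw [polarize_of_le H hx.le, H.reflect_eq_self hx, max_self]
  · have h2 := congrFun h1 x
    simp only [L, Pi.zero_apply, mul_eq_zero, sub_eq_zero] at h2
    rcases h2 with h2 | (h2 | h2) | h2
    · exact h2.symm
    · norm_num at h2
    · exact absurd h2 hx
    · exact absurd h2 hH.ne'

/-- Pointwise convergence of an equicontinuous family with supports in a fixed ball is uniform. -/
lemma eventually_abs_sub_le {ι : Type*} {l : Filter ι} [l.NeBot] {F : ι → E N → ℝ}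
    (hf : UniformContinuous f) (hF : ∀ i, InheritsFrom f R (F i)) (hg : InheritsFrom f R g)
    (hlim : ∀ x, Tendsto (fun i => F i x) l (𝓝 (g x))) {ε : ℝ} (hε : 0 < ε) :
    ∀ᶠ i in l, ∀ x, |F i x - g x| ≤ ε := by
  obtain ⟨δ, hδ, h⟩ := uniform (R := R) hf (show 0 < ε / 3 by positivity)
  obtain ⟨t, -, ht, hcov⟩ := (isCompact_closedBall (0 : E N) R).finite_cover_balls hδ
  have h1 : ∀ᶠ i in l, ∀ y ∈ t, |F i y - g y| ≤ ε / 3 := by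
    rw [Filter.eventually_all_finite ht]
    intro y _
    filter_upwards [Metric.tendsto_nhds.1 (hlim y) (ε / 3) (by positivity)] with i hi
    exact hi.le
  filter_upwards [h1] with i hi x
  by_cases hx : x ∈ Metric.closedBall (0 : E N) R
  · obtain ⟨y, hy, hxy⟩ := Set.mem_iUnion₂.1 (hcov hx)
    have e : F i x - g x = (F i x - F i y) + (F i y - g y) + (g y - g x) := by ring
    rw [e]
    have a1 := h _ (hF i) x y (Metric.mem_ball.1 hxy).le
    have a2 := h _ hg y x (by rw [dist_comm]; exact (Metric.mem_ball.1 hxy).le)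
    calc _ ≤ |F i x - F i y| + |F i y - g y| + |g y - g x| := abs_add_three _ _ _
      _ ≤ ε / 3 + ε / 3 + ε / 3 := by gcongr; exact hi y hy
      _ = ε := by ring
  · have hx' : R < ‖x‖ := by simpa using hx
    simp [(hF i).eq_zero x hx', hg.eq_zero x hx', hε.le]

/-- The class is closed under pointwise limits. -/
lemma of_tendsto {ι : Type*} {l : Filter ι} [l.NeBot] {F : ι → E N → ℝ}
    (hF : ∀ i, InheritsFrom f R (F i)) (hlim : ∀ x, Tendsto (fun i => F i x) l (𝓝 (g x))) :
    InheritsFrom f R g where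
  nonneg x := ge_of_tendsto' (hlim x) fun i => (hF i).nonneg x
  eq_zero x hx := tendsto_nhds_unique (hlim x) (by
    simp only [fun i => (hF i).eq_zero x hx]; exact tendsto_const_nhds)
  le M hM x := le_of_tendsto' (hlim x) fun i => (hF i).le M hM x
  modulus δ ε h x y hxy := le_of_tendsto' ((hlim x).sub (hlim y)).abs
    fun i => (hF i).modulus δ ε h x y hxy

end InheritsFrom

/-- A continuous function that is unchanged by a dense family of polarizations decreases with the
distance to the origin: two points `y`, `x` with `‖y‖ < ‖x‖` are exchanged by the reflection in
the bisector of the segment `[x, y]`. -/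
lemma le_of_polarize_eq_self {N : ℕ} {H : ℕ → HalfSpace N}
    (hdense : {K : HalfSpace N | (0 : E N) ∈ K.carrier} ⊆ closure (Set.range H))
    {v : E N → ℝ} (hv : Continuous v) (hpol : ∀ k, polarize (H k) v = v) {x y : E N}
    (hxy : ‖y‖ < ‖x‖) : v x ≤ v y := by
  have hne : x - y ≠ 0 := fun h => by rw [sub_eq_zero.1 h] at hxy; exact lt_irrefl _ hxy
  have hpos : 0 < ‖x - y‖ := norm_pos_iff.2 hne
  let K : HalfSpace N := ⟨‖x - y‖⁻¹ • (x - y), (‖x‖ ^ 2 - ‖y‖ ^ 2) / (2 * ‖x - y‖), by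
    rw [norm_smul, norm_inv, norm_norm, inv_mul_cancel₀ hpos.ne']⟩
  have hK0 : (0 : E N) ∈ K.carrier := by
    rw [K.mem_carrier, inner_zero_right]
    have : ‖y‖ ^ 2 ≤ ‖x‖ ^ 2 := by gcongr
    exact div_nonneg (by linarith) (by positivity)
  have hnsq : ‖x - y‖ ^ 2 = ‖x‖ ^ 2 - 2 * inner ℝ x y + ‖y‖ ^ 2 := norm_sub_sq_real x y
  have hs : inner ℝ K.normal y - K.offset = - (‖x - y‖ / 2) := by
    simp only [K, real_inner_smul_left, inner_sub_left, real_inner_self_eq_norm_sq]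
    field_simp
    rw [hnsq]
    ring
  have hKy : K.reflect y = x := by
    rw [HalfSpace.reflect, hs]
    simp only [K, smul_smul]
    rw [show 2 * -(‖x - y‖ / 2) * ‖x - y‖⁻¹ = -1 by field_simp]
    module
  have hcn : Continuous fun K' : HalfSpace N => (K'.normal, K'.offset) := continuous_induced_dom
  have hcl : IsClosed {K' : HalfSpace N |
      v (K'.reflect y) ≤ v y ∨ K'.offset ≤ inner ℝ K'.normal y} := by
    have h1 : Continuous fun K' : HalfSpace N => K'.normal := hcn.fst
    have h2 : Continuous fun K' : HalfSpace N => K'.offset := hcn.snd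
    have h3 : Continuous fun K' : HalfSpace N => K'.reflect y := by
      simp only [HalfSpace.reflect]
      fun_prop
    exact (isClosed_le (hv.comp h3) continuous_const).union
      (isClosed_le h2 (h1.inner continuous_const))
  have hmem : K ∈ {K' : HalfSpace N |
      v (K'.reflect y) ≤ v y ∨ K'.offset ≤ inner ℝ K'.normal y} := by
    refine (hcl.closure_subset_iff.2 ?_) (hdense hK0)
    rintro _ ⟨k, rfl⟩
    rcases le_total (inner ℝ (H k).normal y) (H k).offset with h | h
    · left
      have := congrFun (hpol k) y
      rw [polarize_of_le _ h] at this
      rw [← this]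
      exact le_max_right _ _
    · exact Or.inr h
  rcases hmem with h | h
  · rwa [hKy] at h
  · linarith

/-- Along an ultrafilter, the iterated polarizations of a nonnegative continuous function with
compact support converge in `L^p` to a function that decreases with the distance to the origin.
The second moments of the `u_n` decrease to a limit, so that the second moment of the limit function
is not changed by the polarizations `H k`; therefore neither is the limit function. -/
theorem exists_tendsto_polarizeSeq_of_continuous {N : ℕ} {H : ℕ → HalfSpace N}
    (hH : ∀ k, (0 : E N) ∈ interior (H k).carrier)
    (hdense : {K : HalfSpace N | (0 : E N) ∈ K.carrier} ⊆ closure (Set.range H))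
    {f : E N → ℝ} (hfc : Continuous f) (hfs : HasCompactSupport f) (hf0 : ∀ x, 0 ≤ f x)
    (p : ℝ≥0∞) (𝒰 : Ultrafilter ℕ) (h𝒰 : (𝒰 : Filter ℕ) ≤ atTop) :
    ∃ v : E N → ℝ, Continuous v ∧ HasCompactSupport v ∧ (∀ x, 0 ≤ v x) ∧
      (∀ x y, ‖y‖ < ‖x‖ → v x ≤ v y) ∧
      Tendsto (fun n => eLpNorm (polarizeSeq H f n - v) p volume) 𝒰 (𝓝 0) := by
  have hpos : ∀ k, 0 < (H k).offset := fun k => (H k).offset_pos (hH k)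
  have huc : UniformContinuous f := hfs.uniformContinuous_of_continuous hfc
  obtain ⟨R, hR⟩ := hfs.isCompact.isBounded.subset_closedBall (0 : E N)
  obtain ⟨M, hM⟩ : ∃ M, ∀ x, f x ≤ M := by
    obtain ⟨C, hC⟩ := hfs.exists_bound_of_continuous hfc
    exact ⟨C, fun x => (le_abs_self _).trans (hC x)⟩
  have hself : InheritsFrom f R f := ⟨hf0, fun x hx => by
    by_contra h
    have := hR (subset_tsupport f h)
    rw [mem_closedBall_zero_iff] at this
    linarith, fun M h => h, fun δ ε h => h⟩
  have hstep : ∀ k w, InheritsFrom f R w → InheritsFrom f R (polarize (H k) w) :=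
    fun k w hw => hw.polarize _ (hpos k).le
  have hseq : ∀ n, InheritsFrom f R (polarizeSeq H f n) := polarizeSeq_induction hstep hself
  have hlim : ∀ x, ∃ y, Tendsto (fun n => polarizeSeq H f n x) 𝒰 (𝓝 y) := by
    intro x
    obtain ⟨y, -, hy⟩ := (isCompact_Icc (a := (0 : ℝ)) (b := M)).ultrafilter_le_nhds
      (𝒰.map fun n => polarizeSeq H f n x) (by
        rw [le_principal_iff]
        exact Filter.mem_map.2 (Filter.Eventually.of_forall fun n =>
          ⟨(hseq n).nonneg x, (hseq n).le M hM x⟩))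
    exact ⟨y, hy⟩
  choose v hv using hlim
  have hvI : InheritsFrom f R v := .of_tendsto hseq hv
  have hunif : ∀ {ε : ℝ}, 0 < ε → ∀ᶠ n in (𝒰 : Filter ℕ), ∀ x, |polarizeSeq H f n x - v x| ≤ ε :=
    fun hε => InheritsFrom.eventually_abs_sub_le huc hseq hvI hv hε
  set I : (E N → ℝ) → ℝ := fun g => ∫ x, g x * ‖x‖ ^ 2
  have hIanti : ∀ w, InheritsFrom f R w → Antitone fun m => I (polarizeIter H w m) := by
    intro w hw
    refine antitone_nat_of_succ_le fun m => ?_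
    exact ((polarizeIter_induction hstep hw m).integral_polarize_le huc (H m) (hpos m)).1
  have hSanti : Antitone fun n => I (polarizeSeq H f n) :=
    antitone_nat_of_succ_le fun n => hIanti _ (hseq n) (Nat.zero_le (n + 1))
  have hbdd : BddBelow (Set.range fun n => I (polarizeSeq H f n)) := by
    refine ⟨0, ?_⟩
    rintro _ ⟨n, rfl⟩
    exact integral_nonneg fun x => mul_nonneg ((hseq n).nonneg x) (sq_nonneg _)
  set Λ := ⨅ n, I (polarizeSeq H f n)
  have hΛ : Tendsto (fun n => I (polarizeSeq H f n)) atTop (𝓝 Λ) :=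
    tendsto_atTop_ciInf hSanti hbdd
  have hIter : ∀ m, I (polarizeIter H v m) = Λ := by
    intro m
    have hvm := polarizeIter_induction hstep hvI m
    have hnm : ∀ n, InheritsFrom f R (polarizeIter H (polarizeSeq H f n) m) :=
      fun n => polarizeIter_induction hstep (hseq n) m
    have t1 : Tendsto (fun n => I (polarizeIter H (polarizeSeq H f n) m)) 𝒰 (𝓝 Λ) := by
      have e1 : ∀ᶠ n in (𝒰 : Filter ℕ), m ≤ n := h𝒰 (eventually_ge_atTop m)
      refine tendsto_of_tendsto_of_tendsto_of_le_of_le'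
        ((hΛ.comp (tendsto_add_atTop_nat 1)).mono_left h𝒰) (hΛ.mono_left h𝒰) ?_ ?_
      · filter_upwards [e1] with n hn
        exact hIanti _ (hseq n) (show m ≤ n + 1 by omega)
      · exact Filter.Eventually.of_forall fun n => hIanti _ (hseq n) (Nat.zero_le m)
    have t2 : Tendsto (fun n => I (polarizeIter H (polarizeSeq H f n) m)) 𝒰
        (𝓝 (I (polarizeIter H v m))) := by
      rw [Metric.tendsto_nhds]
      intro ε hε
      set C := ∫ x in Metric.closedBall (0 : E N) R, ‖x‖ ^ 2
      have hC : 0 ≤ C := integral_nonneg fun x => sq_nonneg _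
      filter_upwards [hunif (show 0 < ε / (C + 1) by positivity)] with n hn
      have h1 : ∀ x, |polarizeIter H (polarizeSeq H f n) m x - polarizeIter H v m x|
          ≤ ε / (C + 1) :=
        polarizeIter_induction₂
          (P := fun w z => ∀ x, |w x - z x| ≤ ε / (C + 1))
          (fun k w z h => abs_polarize_sub_le (H k) h) hn m
      refine ((hnm n).abs_integral_sub_le huc hvm h1).trans_lt ?_
      rw [div_mul_eq_mul_div, div_lt_iff₀ (by positivity)]
      change ε * C < _
      nlinarith
    exact tendsto_nhds_unique t2 t1
  have hfix : ∀ m, polarizeIter H v m = v := by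
    intro m
    induction m with
    | zero => rfl
    | succ m ih =>
      have h1 := hIter (m + 1)
      have h2 := hIter 0
      change I (polarize (H m) (polarizeIter H v m)) = Λ at h1
      change polarize (H m) (polarizeIter H v m) = v
      rw [ih] at h1 ⊢
      exact (hvI.integral_polarize_le huc (H m) (hpos m)).2 (h1.trans h2.symm)
  have hpol : ∀ k, polarize (H k) v = v := fun k => by
    have := hfix (k + 1)
    change polarize (H k) (polarizeIter H v k) = v at this
    rwa [hfix k] at this
  refine ⟨v, hvI.continuous huc, hvI.hasCompactSupport, hvI.nonneg,
    fun x y hxy => le_of_polarize_eq_self hdense (hvI.continuous huc) hpol hxy, ?_⟩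
  rw [ENNReal.tendsto_nhds_zero]
  intro ε hε
  have hvol : volume (Metric.closedBall (0 : E N) R) ^ p.toReal⁻¹ ≠ ⊤ :=
    ENNReal.rpow_ne_top_of_nonneg (by positivity) measure_closedBall_lt_top.ne
  obtain ⟨η, hη, hlt⟩ := ENNReal.exists_nnreal_pos_mul_lt hvol hε.ne'
  filter_upwards [hunif (show (0 : ℝ) < η from hη)] with n hn
  refine ((hseq n).eLpNorm_sub_le hvI hn p).trans ?_
  rw [mul_comm]
  exact hlt.le

/-! ### Characterization of the Schwarz symmetrization -/

/-- Continuity of the measure along the increasing sets `{t + ε < v}`, as `ε` decreases to `0`. -/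
lemma volume_lt_le_of_forall_add {N : ℕ} {v : E N → ℝ} {t : ℝ} {c : ℝ≥0∞}
    (h : ∀ ε > 0, volume {x | t + ε < v x} ≤ c) : volume {x | t < v x} ≤ c := by
  have h1 : {x | t < v x} = ⋃ k : ℕ, {x | t + 1 / ((k : ℝ) + 1) < v x} := by
    ext x
    simp only [Set.mem_ofPred_eq, Set.mem_iUnion]
    constructor
    · intro hx
      obtain ⟨k, hk⟩ := exists_nat_one_div_lt (sub_pos.2 hx)
      exact ⟨k, by linarith⟩
    · rintro ⟨k, hk⟩
      have : (0 : ℝ) < 1 / ((k : ℝ) + 1) := by positivity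
      linarith
  have hmono : Monotone fun k : ℕ => {x | t + 1 / ((k : ℝ) + 1) < v x} := by
    intro k m hkm x hx
    simp only [Set.mem_ofPred_eq] at hx ⊢
    have : 1 / ((m : ℝ) + 1) ≤ 1 / ((k : ℝ) + 1) := by gcongr
    linarith
  rw [h1, hmono.measure_iUnion]
  exact iSup_le fun k => h _ (by positivity)

/-- Limits in measure of functions with a given distribution have the same distribution. -/
lemma volume_lt_eq_of_tendstoInMeasure {N : ℕ} {ι : Type*} {l : Filter ι} [l.NeBot]
    {w : ι → E N → ℝ} {u v : E N → ℝ} (hw : ∀ i t, volume {x | t < w i x} = volume {x | t < u x})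
    (h : TendstoInMeasure volume w l v) (t : ℝ) : volume {x | t < v x} = volume {x | t < u x} := by
  have hle : ∀ ε > 0, ∀ η > 0, ∃ i, volume {x | ENNReal.ofReal ε ≤ edist (w i x) (v x)} ≤ η := by
    intro ε hε η hη
    exact ((ENNReal.tendsto_nhds_zero.1 (h _ (ENNReal.ofReal_pos.2 hε))) η hη).exists
  have hsub : ∀ {a b : E N → ℝ} (ε : ℝ), {x | t + ε < a x} ⊆
      {x | t < b x} ∪ {x | ENNReal.ofReal ε ≤ edist (a x) (b x)} := by
    intro a b ε x hx
    by_cases hb : t < b x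
    · exact Or.inl hb
    · right
      simp only [Set.mem_ofPred_eq] at hx ⊢
      rw [edist_dist]
      refine ENNReal.ofReal_le_ofReal ?_
      rw [Real.dist_eq]
      exact le_trans (by linarith) (le_abs_self _)
  refine le_antisymm ?_ ?_
  · refine volume_lt_le_of_forall_add fun ε hε => ?_
    refine ENNReal.le_of_forall_pos_le_add fun η hη _ => ?_
    obtain ⟨i, hi⟩ := hle ε hε η (by exact_mod_cast hη)
    refine (measure_mono (hsub (b := w i) ε)).trans ((measure_union_le _ _).trans ?_)
    rw [hw i t]
    gcongr
    simpa only [edist_comm] using hi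
  · refine volume_lt_le_of_forall_add fun ε hε => ?_
    refine ENNReal.le_of_forall_pos_le_add fun η hη _ => ?_
    obtain ⟨i, hi⟩ := hle ε hε η (by exact_mod_cast hη)
    rw [← hw i]
    refine (measure_mono (hsub (b := v) ε)).trans ((measure_union_le _ _).trans ?_)
    gcongr

lemma nontrivial_euclidean {N : ℕ} (hN : 1 ≤ N) : Nontrivial (E N) := by
  have : Nonempty (Fin N) := ⟨⟨0, hN⟩⟩
  infer_instance

lemma volume_ball_lt_volume_ball {N : ℕ} (hN : 1 ≤ N) {r s : ℝ} (hr : 0 ≤ r) (hrs : r < s) :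
    volume (Metric.ball (0 : E N) r) < volume (Metric.ball (0 : E N) s) := by
  have := nontrivial_euclidean hN
  rw [Measure.addHaar_ball _ _ hr, Measure.addHaar_ball _ _ (hr.trans hrs.le)]
  refine (ENNReal.mul_lt_mul_iff_left (Metric.measure_ball_pos _ _ one_pos).ne'
    measure_ball_lt_top.ne).2 ?_
  refine (ENNReal.ofReal_lt_ofReal_iff (by have := hr.trans_lt hrs; positivity)).2 ?_
  refine pow_lt_pow_left₀ hrs hr ?_
  simp only [finrank_euclideanSpace, Fintype.card_fin]
  omega

lemma ae_volume_ball_ne {N : ℕ} (hN : 1 ≤ N) (c : ℝ≥0∞) :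
    ∀ᵐ x : E N, volume (Metric.ball (0 : E N) ‖x‖) ≠ c := by
  have := nontrivial_euclidean hN
  by_cases h : ∃ x₀ : E N, volume (Metric.ball (0 : E N) ‖x₀‖) = c
  · obtain ⟨x₀, h₀⟩ := h
    refine measure_mono_null ?_ (Measure.addHaar_sphere volume (0 : E N) ‖x₀‖)
    intro x hx
    simp only [ne_eq, Set.mem_compl_iff, Set.mem_ofPred_eq, not_not] at hx
    rw [mem_sphere_zero_iff_norm]
    rcases lt_trichotomy ‖x‖ ‖x₀‖ with h | h | h
    · exact absurd (hx.trans h₀.symm) (volume_ball_lt_volume_ball hN (norm_nonneg _) h).ne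
    · exact h
    · exact absurd (hx.trans h₀.symm) (volume_ball_lt_volume_ball hN (norm_nonneg _) h).ne'
  · push Not at h
    exact .of_forall h

lemma schwarz_nonneg {N : ℕ} (u : E N → ℝ) (x : E N) : 0 ≤ schwarz u x :=
  Real.sSup_nonneg fun _ ht => ht.1

/-- A nonnegative function that decreases with the distance to the origin, up to a null set, and
has the distribution of `u` is the Schwarz symmetrization of `u`. -/
lemma ae_eq_schwarz {N : ℕ} (hN : 1 ≤ N) {u v : E N → ℝ} (hv0 : 0 ≤ᵐ[volume] v)
    (hdist : ∀ t, volume {x | t < v x} = volume {x | t < u x}) {P : E N → Prop}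
    (hP : ∀ᵐ x, P x) (hanti : ∀ x y, P x → P y → ‖y‖ < ‖x‖ → v x ≤ v y) :
    v =ᵐ[volume] schwarz u := by
  have := nontrivial_euclidean hN
  -- For each level `q`, the exceptional `x` lie on a single sphere. Rational levels suffice below.
  have hq : ∀ᵐ x : E N, ∀ q : ℚ, volume (Metric.ball (0 : E N) ‖x‖) ≠ volume {y | (q : ℝ) < u y} :=
    ae_all_iff.2 fun q => ae_volume_ball_ne hN _
  filter_upwards [hv0, hP, hq] with x hx0 hPx hqx
  simp only [Pi.zero_apply] at hx0
  have hball : ∀ t < v x, volume (Metric.ball (0 : E N) ‖x‖) ≤ volume {y | t < u y} := by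
    intro t ht
    rw [← hdist]
    refine measure_mono_ae ?_
    filter_upwards [hP] with y hPy hy
    exact ht.trans_le (hanti x y hPx hPy (mem_ball_zero_iff.1 hy))
  have hub : ∀ t, volume (Metric.ball (0 : E N) ‖x‖) < volume {y | t < u y} → t < v x := by
    intro t ht
    rw [← hdist, ← Measure.addHaar_closedBall_eq_addHaar_ball] at ht
    by_contra hle
    refine absurd (measure_mono_ae ?_) (not_le.2 ht)
    filter_upwards [hP] with y hPy hy
    by_contra hy'
    have hy' : ‖x‖ < ‖y‖ := by
      rw [← not_le]
      exact fun h => hy' (mem_closedBall_zero_iff.2 h)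
    have h1 := hanti y x hPy hPx hy'
    have h2 : t < v y := hy
    linarith
  refine le_antisymm ?_ (Real.sSup_le (fun t ht => (hub t ht.2).le) hx0)
  by_contra hlt
  rw [not_le] at hlt
  obtain ⟨q, hq1, hq2⟩ := exists_rat_btwn hlt
  have hmem : (q : ℝ) ∈ {t : ℝ | 0 ≤ t ∧
      volume (Metric.ball (0 : E N) ‖x‖) < volume {y : E N | t < u y}} :=
    ⟨(schwarz_nonneg u x).trans hq1.le, lt_of_le_of_ne (hball _ hq2) (hqx q)⟩
  exact absurd (le_csSup ⟨v x, fun t ht => (hub t ht.2).le⟩ hmem) (not_le.2 hq1)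

/-! ### Approximation of the symmetrization in `L^p` -/

lemma volume_lt_polarizeSeq {N : ℕ} (H : ℕ → HalfSpace N) {u : E N → ℝ}
    (hu : AEMeasurable u volume) (n : ℕ) (t : ℝ) :
    volume {x | t < polarizeSeq H u n x} = volume {x | t < u x} := by
  refine (polarizeSeq_induction (P := fun w => AEMeasurable w volume ∧
    volume {x | t < w x} = volume {x | t < u x}) (fun k w hw => ?_) ⟨hu, rfl⟩ n).2
  exact ⟨aemeasurable_polarize _ hw.1, (volume_lt_polarize _ hw.1 t).trans hw.2⟩

lemma memLp_polarizeSeq {N : ℕ} (H : ℕ → HalfSpace N) {p : ℝ≥0∞} (hp1 : 1 ≤ p) (hp : p ≠ ⊤)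
    {u : E N → ℝ} (hu : MemLp u p volume) (n : ℕ) : MemLp (polarizeSeq H u n) p volume :=
  polarizeSeq_induction (P := fun w => MemLp w p volume)
    (fun k _ hw => memLp_polarize (H k) hp1 hp hw) hu n

lemma eLpNorm_polarizeSeq_sub_le {N : ℕ} (H : ℕ → HalfSpace N) {p : ℝ≥0∞} (hp1 : 1 ≤ p)
    (hp : p ≠ ⊤) {u v : E N → ℝ} (hu : AEMeasurable u volume) (hv : AEMeasurable v volume) (n : ℕ) :
    eLpNorm (polarizeSeq H u n - polarizeSeq H v n) p volume ≤ eLpNorm (u - v) p volume := by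
  refine (polarizeSeq_induction₂ (P := fun w z => AEMeasurable w volume ∧ AEMeasurable z volume ∧
    eLpNorm (w - z) p volume ≤ eLpNorm (u - v) p volume) (fun k w z h => ?_)
    ⟨hu, hv, le_rfl⟩ n).2.2
  exact ⟨aemeasurable_polarize _ h.1, aemeasurable_polarize _ h.2.1,
    (eLpNorm_polarize_sub_le _ hp1 hp h.1 h.2.1).trans h.2.2⟩

lemma eLpNorm_sub_triangle {N : ℕ} {p : ℝ≥0∞} (hp1 : 1 ≤ p) {a b c : E N → ℝ}
    (ha : AEStronglyMeasurable a volume) (hb : AEStronglyMeasurable b volume)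
    (hc : AEStronglyMeasurable c volume) :
    eLpNorm (a - c) p volume ≤ eLpNorm (a - b) p volume + eLpNorm (b - c) p volume := by
  have := eLpNorm_add_le (ha.sub hb) (hb.sub hc) hp1
  rwa [sub_add_sub_cancel] at this

/-- The `L^p` version, up to an error `ε`, of the convergence for continuous functions: approximate
`u` by such a function and use that polarization is nonexpansive. -/
lemma exists_eventually_eLpNorm_polarizeSeq_sub_le {N : ℕ} {H : ℕ → HalfSpace N}
    (hH : ∀ k, (0 : E N) ∈ interior (H k).carrier)
    (hdense : {K : HalfSpace N | (0 : E N) ∈ K.carrier} ⊆ closure (Set.range H))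
    {p : ℝ≥0∞} (hp1 : 1 ≤ p) (hp : p ≠ ⊤) {u : E N → ℝ} (hu : MemLp u p volume)
    (hu0 : 0 ≤ᵐ[volume] u) (𝒰 : Ultrafilter ℕ) (h𝒰 : (𝒰 : Filter ℕ) ≤ atTop)
    {ε : ℝ≥0∞} (hε : ε ≠ 0) :
    ∃ w : E N → ℝ, MemLp w p volume ∧ (∀ x, 0 ≤ w x) ∧ (∀ x y, ‖y‖ < ‖x‖ → w x ≤ w y) ∧
      ∀ᶠ n in (𝒰 : Filter ℕ), eLpNorm (polarizeSeq H u n - w) p volume ≤ ε := by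
  have hε2 : ε / 2 ≠ 0 := (ENNReal.half_pos hε).ne'
  obtain ⟨f, hfs, hfu, hfc, hfp⟩ := hu.exists_hasCompactSupport_eLpNorm_sub_le hp hε2
  set g : E N → ℝ := fun x => max (f x) 0
  have hgc : Continuous g := hfc.max continuous_const
  have hgs : HasCompactSupport g := hfs.comp_left (g := fun y : ℝ => max y 0) (max_self 0)
  have hgu : eLpNorm (u - g) p volume ≤ ε / 2 := by
    refine (eLpNorm_mono_ae ?_).trans hfu
    filter_upwards [hu0] with x hx
    have hx : 0 ≤ u x := hx
    simp only [Pi.sub_apply, Real.norm_eq_abs, g]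
    have h2 := abs_max_sub_max_le_abs (u x) (f x) 0
    rwa [max_eq_left hx] at h2
  obtain ⟨w, hwc, hws, hw0, hwa, hwl⟩ := exists_tendsto_polarizeSeq_of_continuous hH hdense hgc hgs
    (fun x => le_max_right _ _) p 𝒰 h𝒰
  have hwp : MemLp w p volume := hwc.memLp_of_hasCompactSupport hws
  have hgp : MemLp g p volume := hgc.memLp_of_hasCompactSupport hgs
  refine ⟨w, hwp, hw0, hwa, ?_⟩
  filter_upwards [ENNReal.tendsto_nhds_zero.1 hwl _ (ENNReal.half_pos hε)] with n hn
  calc eLpNorm (polarizeSeq H u n - w) p volume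
      ≤ eLpNorm (polarizeSeq H u n - polarizeSeq H g n) p volume +
        eLpNorm (polarizeSeq H g n - w) p volume :=
        eLpNorm_sub_triangle hp1 (memLp_polarizeSeq H hp1 hp hu n).1
          (memLp_polarizeSeq H hp1 hp hgp n).1 hwp.1
    _ ≤ ε / 2 + ε / 2 := by
        gcongr
        exact (eLpNorm_polarizeSeq_sub_le H hp1 hp hu.1.aemeasurable hgp.1.aemeasurable n).trans hgu
    _ = ε := ENNReal.add_halves ε

lemma tendsto_polarizeSeq_ultrafilter {N : ℕ} (hN : 1 ≤ N) {H : ℕ → HalfSpace N}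
    (hH : ∀ k, (0 : E N) ∈ interior (H k).carrier)
    (hdense : {K : HalfSpace N | (0 : E N) ∈ K.carrier} ⊆ closure (Set.range H))
    {p : ℝ≥0∞} (hp1 : 1 ≤ p) (hp : p ≠ ⊤) {u : E N → ℝ} (hu : MemLp u p volume)
    (hu0 : 0 ≤ᵐ[volume] u) (𝒰 : Ultrafilter ℕ) (h𝒰 : (𝒰 : Filter ℕ) ≤ atTop) :
    MemLp (schwarz u) p volume ∧
      Tendsto (fun n => eLpNorm (polarizeSeq H u n - schwarz u) p volume) 𝒰 (𝓝 0) := by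
  have : Fact (1 ≤ p) := ⟨hp1⟩
  have hp0 : p ≠ 0 := (zero_lt_one.trans_le hp1).ne'
  have hun := memLp_polarizeSeq H hp1 hp hu
  have happ := fun {ε : ℝ≥0∞} (hε : ε ≠ 0) => exists_eventually_eLpNorm_polarizeSeq_sub_le hH hdense
    hp1 hp hu hu0 𝒰 h𝒰 hε
  have hcauchy : Cauchy ((𝒰 : Filter ℕ).map fun n => (hun n).toLp _) := by
    rw [EMetric.cauchy_iff]
    refine ⟨(inferInstance : NeBot _).ne, fun ε hε => ?_⟩
    obtain ⟨δ, hδ, hδε⟩ := ENNReal.lt_iff_exists_nnreal_btwn.1 (show 0 < ε from hε)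
    have hδ2 : (δ : ℝ≥0∞) / 2 ≠ 0 := (ENNReal.half_pos hδ.ne').ne'
    obtain ⟨w, hwp, -, -, hw⟩ := happ hδ2
    refine ⟨{F | eLpNorm (⇑F - w) p volume ≤ δ / 2}, ?_, fun F hF G hG => ?_⟩
    · rw [Filter.mem_map]
      filter_upwards [hw] with n hn
      refine le_trans (le_of_eq (eLpNorm_congr_ae ?_)) hn
      exact (hun n).coeFn_toLp.sub .rfl
    · rw [Lp.edist_def]
      refine lt_of_le_of_lt ?_ hδε
      calc eLpNorm (⇑F - ⇑G) p volume ≤ eLpNorm (⇑F - w) p volume + eLpNorm (w - ⇑G) p volume :=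
            eLpNorm_sub_triangle hp1 (Lp.aestronglyMeasurable F) hwp.1 (Lp.aestronglyMeasurable G)
        _ ≤ δ / 2 + δ / 2 := by
            rw [eLpNorm_sub_comm w]
            exact add_le_add hF hG
        _ = δ := ENNReal.add_halves _
  obtain ⟨V, hV⟩ := CompleteSpace.complete hcauchy
  have hlim : Tendsto (fun n => eLpNorm (polarizeSeq H u n - ⇑V) p volume) 𝒰 (𝓝 0) := by
    have h1 : Tendsto (fun n => edist ((hun n).toLp _) V) 𝒰 (𝓝 0) :=
      tendsto_iff_edist_tendsto_0.1 hV
    refine h1.congr fun n => ?_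
    rw [Lp.edist_def]
    exact eLpNorm_congr_ae ((hun n).coeFn_toLp.sub .rfl)
  have hmeas : TendstoInMeasure volume (polarizeSeq H u) 𝒰 V :=
    tendstoInMeasure_of_tendsto_eLpNorm hp0 (fun n => (hun n).1) (Lp.aestronglyMeasurable V) hlim
  have hdist := volume_lt_eq_of_tendstoInMeasure
    (volume_lt_polarizeSeq H hu.1.aemeasurable) hmeas
  -- `V` is an a.e. limit of functions that decrease with the distance to the origin.
  have hw : ∀ k : ℕ, ∃ w : E N → ℝ, MemLp w p volume ∧ (∀ x, 0 ≤ w x) ∧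
      (∀ x y, ‖y‖ < ‖x‖ → w x ≤ w y) ∧
      eLpNorm (w - ⇑V) p volume ≤ (k : ℝ≥0∞)⁻¹ + (k : ℝ≥0∞)⁻¹ := by
    intro k
    have hk : (k : ℝ≥0∞)⁻¹ ≠ 0 := by simp
    obtain ⟨w, hwp, hw0, hwa, hwe⟩ := happ hk
    obtain ⟨n, hn1, hn2⟩ :=
      (hwe.and (ENNReal.tendsto_nhds_zero.1 hlim _ (pos_iff_ne_zero.2 hk))).exists
    refine ⟨w, hwp, hw0, hwa, ?_⟩
    refine (eLpNorm_sub_triangle hp1 hwp.1 (hun n).1 (Lp.aestronglyMeasurable V)).trans ?_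
    rw [eLpNorm_sub_comm w]
    exact add_le_add hn1 hn2
  choose w hwp hw0 hwa hwV using hw
  have hwlim : Tendsto (fun k => eLpNorm (w k - ⇑V) p volume) atTop (𝓝 0) := by
    refine tendsto_of_tendsto_of_tendsto_of_le_of_le tendsto_const_nhds ?_ (fun _ => zero_le) hwV
    have := ENNReal.tendsto_inv_nat_nhds_zero.add ENNReal.tendsto_inv_nat_nhds_zero
    rwa [add_zero] at this
  obtain ⟨ns, -, hns⟩ := (tendstoInMeasure_of_tendsto_eLpNorm hp0 (fun n => (hwp n).1)
    (Lp.aestronglyMeasurable V) hwlim).exists_seq_tendsto_ae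
  have hV0 : 0 ≤ᵐ[volume] V := by
    filter_upwards [hns] with x hx
    exact ge_of_tendsto' hx fun k => hw0 _ x
  have hVs : V =ᵐ[volume] schwarz u := by
    refine ae_eq_schwarz hN hV0 hdist hns fun x y hx hy hxy => ?_
    exact le_of_tendsto_of_tendsto' hx hy fun k => hwa _ x y hxy
  refine ⟨(Lp.memLp V).ae_eq hVs, hlim.congr fun n => ?_⟩
  exact eLpNorm_congr_ae (EventuallyEq.rfl.sub hVs)

/-- The iterated polarizations `u_n` converge to the Schwarz symmetrization in `L^p`. -/
theorem tendsto_polarizeSeq {N : ℕ} (hN : 1 ≤ N) {H : ℕ → HalfSpace N}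
    (hH : ∀ k, (0 : E N) ∈ interior (H k).carrier)
    (hdense : {K : HalfSpace N | (0 : E N) ∈ K.carrier} ⊆ closure (Set.range H))
    {p : ℝ≥0∞} (hp1 : 1 ≤ p) (hp : p ≠ ⊤) {u : E N → ℝ} (hu : MemLp u p volume)
    (hu0 : 0 ≤ᵐ[volume] u) :
    MemLp (schwarz u) p volume ∧
      Tendsto (fun n => eLpNorm (polarizeSeq H u n - schwarz u) p volume) atTop (𝓝 0) := by
  have h := tendsto_polarizeSeq_ultrafilter hN hH hdense hp1 hp hu hu0
  exact ⟨(h (Ultrafilter.of atTop) (Ultrafilter.of_le _)).1,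
    tendsto_iff_ultrafilter _ _ _ |>.2 fun 𝒰 h𝒰 => (h 𝒰 h𝒰).2⟩

/-! ### Uniform convexity -/

section uniform_convexity

variable {F : Type*} [NormedAddCommGroup F] [InnerProductSpace ℝ F]

lemma norm_half_smul_add_rpow_lt {r : ℝ} (hr : 1 < r) {a b : F} (hab : a ≠ b) :
    ‖(1 / 2 : ℝ) • (a + b)‖ ^ r < (‖a‖ ^ r + ‖b‖ ^ r) / 2 := by
  have hr0 : 0 < r := by linarith
  by_cases h : ‖a‖ = ‖b‖
  · have h1 : ‖(1 / 2 : ℝ) • a + (1 / 2 : ℝ) • b‖ < ‖a‖ :=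
      norm_combo_lt_of_ne le_rfl h.ge hab (by norm_num) (by norm_num) (by norm_num)
    rw [← smul_add] at h1
    have := Real.rpow_lt_rpow (norm_nonneg _) h1 hr0
    rw [← h]
    linarith
  · have h1 : ‖(1 / 2 : ℝ) • (a + b)‖ ≤ (1 / 2 : ℝ) • ‖a‖ + (1 / 2 : ℝ) • ‖b‖ := by
      rw [norm_smul, Real.norm_of_nonneg (by norm_num), smul_eq_mul, smul_eq_mul, ← mul_add]
      gcongr
      exact norm_add_le _ _
    have h2 := (strictConvexOn_rpow hr).2 (norm_nonneg a) (norm_nonneg b) h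
      (show (0 : ℝ) < 1 / 2 by norm_num) (show (0 : ℝ) < 1 / 2 by norm_num) (by norm_num)
    have h3 := Real.rpow_le_rpow (norm_nonneg _) h1 hr0.le
    simp only [smul_eq_mul] at h2 h3
    linarith

lemma norm_half_smul_add_rpow_le {r : ℝ} (hr : 1 < r) (a b : F) :
    ‖(1 / 2 : ℝ) • (a + b)‖ ^ r ≤ (‖a‖ ^ r + ‖b‖ ^ r) / 2 := by
  by_cases hab : a = b
  · subst hab
    rw [← two_smul ℝ, smul_smul]
    norm_num
  · exact (norm_half_smul_add_rpow_lt hr hab).le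

/-- Quantitative strict convexity of `‖·‖^r`, by compactness of the unit sphere of `F × F` and
homogeneity. It serves all exponents `r > 1` at once, in place of Clarkson's inequalities. -/
lemma exists_norm_sub_rpow_le [ProperSpace F] {r : ℝ} (hr : 1 < r) {ε : ℝ} (hε : 0 < ε) :
    ∃ C : ℝ, 0 ≤ C ∧ ∀ a b : F, ‖a - b‖ ^ r ≤ ε * (‖a‖ ^ r + ‖b‖ ^ r) +
      C * ((‖a‖ ^ r + ‖b‖ ^ r) / 2 - ‖(1 / 2 : ℝ) • (a + b)‖ ^ r) := by
  have hr0 : 0 < r := by linarith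
  have hpow : ∀ g : F × F → F, Continuous g → Continuous fun z => ‖g z‖ ^ r := fun g hg =>
    hg.norm.rpow_const fun _ => Or.inr hr0.le
  have c1 := hpow _ continuous_fst
  have c2 := hpow _ continuous_snd
  have c3 := hpow _ (continuous_fst.sub continuous_snd)
  have c4 := hpow _ ((continuous_fst.add continuous_snd).const_smul (1 / 2 : ℝ))
  set D : F × F → ℝ := fun z => (‖z.1‖ ^ r + ‖z.2‖ ^ r) / 2 - ‖(1 / 2 : ℝ) • (z.1 + z.2)‖ ^ r
  have hDc : Continuous D := ((c1.add c2).div_const 2).sub c4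
  have hD0 : ∀ z, 0 ≤ D z := fun z => sub_nonneg.2 (norm_half_smul_add_rpow_le hr z.1 z.2)
  set T : Set (F × F) := Metric.sphere 0 1 ∩
    {z | ε * (‖z.1‖ ^ r + ‖z.2‖ ^ r) ≤ ‖z.1 - z.2‖ ^ r}
  have hT : IsCompact T :=
    (isCompact_sphere _ _).inter_right (isClosed_le ((c1.add c2).const_mul ε) c3)
  obtain ⟨m, hm, hmT⟩ : ∃ m > 0, ∀ z ∈ T, m ≤ D z := by
    rcases T.eq_empty_or_nonempty with h | h
    · exact ⟨1, one_pos, by simp [h]⟩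
    · obtain ⟨z, hz, hmin⟩ := hT.exists_isMinOn h hDc.continuousOn
      refine ⟨D z, ?_, fun y hy => hmin hy⟩
      refine sub_pos.2 (norm_half_smul_add_rpow_lt hr fun hab => ?_)
      have h2 := hz.2
      have h1 : ‖z‖ = 1 := mem_sphere_zero_iff_norm.1 hz.1
      simp only [Set.mem_ofPred_eq, hab, sub_self, norm_zero, Real.zero_rpow hr0.ne'] at h2
      have h3 : ‖z.2‖ = 1 := by
        rw [Prod.norm_def, hab, max_self] at h1
        exact h1
      rw [h3, Real.one_rpow] at h2
      linarith
  refine ⟨2 ^ r / m, by positivity, ?_⟩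
  have hsph : ∀ z : F × F, ‖z‖ = 1 →
      ‖z.1 - z.2‖ ^ r ≤ ε * (‖z.1‖ ^ r + ‖z.2‖ ^ r) + 2 ^ r / m * D z := by
    intro z hz
    by_cases hzT : ε * (‖z.1‖ ^ r + ‖z.2‖ ^ r) ≤ ‖z.1 - z.2‖ ^ r
    · have h1 := hmT z ⟨mem_sphere_zero_iff_norm.2 hz, hzT⟩
      have h2 : ‖z.1 - z.2‖ ≤ 2 := by
        have h3 := norm_fst_le z
        have h4 := norm_snd_le z
        linarith [norm_sub_le z.1 z.2]
      have h3 : (2 : ℝ) ^ r ≤ 2 ^ r / m * D z := by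
        rw [div_mul_eq_mul_div, le_div_iff₀ hm]
        gcongr
      have h4 := Real.rpow_le_rpow (norm_nonneg _) h2 hr0.le
      have h5 : 0 ≤ ε * (‖z.1‖ ^ r + ‖z.2‖ ^ r) := by positivity
      linarith
    · have h5 : 0 ≤ 2 ^ r / m * D z := mul_nonneg (by positivity) (hD0 z)
      linarith
  intro a b
  by_cases h0 : ((a, b) : F × F) = 0
  · obtain ⟨rfl, rfl⟩ := Prod.mk_eq_zero.1 h0
    simp [Real.zero_rpow hr0.ne']
  · set s := ‖((a, b) : F × F)‖
    have hs : 0 < s := norm_pos_iff.2 h0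
    have hz : ‖s⁻¹ • ((a, b) : F × F)‖ = 1 := by
      rw [norm_smul, norm_inv, norm_norm]
      exact inv_mul_cancel₀ hs.ne'
    have hsc : ∀ x : F, ‖s⁻¹ • x‖ ^ r = (s⁻¹) ^ r * ‖x‖ ^ r := by
      intro x
      rw [norm_smul, Real.norm_of_nonneg (by positivity),
        Real.mul_rpow (by positivity) (by positivity)]
    have h1 := hsph _ hz
    simp only [D, Prod.smul_mk, ← smul_sub, ← smul_add, smul_comm (1 / 2 : ℝ) s⁻¹, hsc] at h1
    have hc : 0 < (s⁻¹) ^ r := by positivity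
    refine le_of_mul_le_mul_left ?_ hc
    calc _ ≤ _ := h1
      _ = _ := by ring

section Lp

variable {N : ℕ} {p : ℝ≥0∞} [Fact (1 ≤ p)]

lemma Lp_norm_rpow_eq_integral {G : Type*} [NormedAddCommGroup G] (hp : p ≠ ⊤)
    (f : Lp G p (volume : Measure (E N))) :
    ‖f‖ ^ p.toReal = ∫ x, ‖f x‖ ^ p.toReal := by
  have hp0 : p ≠ 0 := (zero_lt_one.trans_le Fact.out).ne'
  have h0 : 0 ≤ ∫ x, ‖f x‖ ^ p.toReal := integral_nonneg fun x => by positivity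
  rw [Lp.norm_def, (Lp.memLp f).eLpNorm_eq_integral_rpow_norm hp0 hp,
    ENNReal.toReal_ofReal (by positivity), ← Real.rpow_mul h0,
    inv_mul_cancel₀ (ENNReal.toReal_pos hp0 hp).ne', Real.rpow_one]

lemma exists_Lp_norm_sub_rpow_le [ProperSpace F] (hp1 : 1 < p) (hp : p ≠ ⊤) {ε : ℝ} (hε : 0 < ε) :
    ∃ C : ℝ, 0 ≤ C ∧ ∀ f g : Lp F p (volume : Measure (E N)),
      ‖f - g‖ ^ p.toReal ≤ ε * (‖f‖ ^ p.toReal + ‖g‖ ^ p.toReal) +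
      C * ((‖f‖ ^ p.toReal + ‖g‖ ^ p.toReal) / 2 - ‖(1 / 2 : ℝ) • (f + g)‖ ^ p.toReal) := by
  have hr : 1 < p.toReal := by
    simpa using (ENNReal.toReal_lt_toReal ENNReal.one_ne_top hp).2 hp1
  have hp0 : p ≠ 0 := (zero_lt_one.trans hp1).ne'
  obtain ⟨C, hC0, hC⟩ := exists_norm_sub_rpow_le (F := F) hr hε
  refine ⟨C, hC0, fun f g => ?_⟩
  have hi : ∀ h : Lp F p (volume : Measure (E N)), Integrable fun x => ‖h x‖ ^ p.toReal := fun h =>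
    (Lp.memLp h).integrable_norm_rpow hp0 hp
  have i1 : Integrable fun x => ε * (‖f x‖ ^ p.toReal + ‖g x‖ ^ p.toReal) :=
    ((hi f).add (hi g)).const_mul ε
  have i2 : Integrable fun x => (‖f x‖ ^ p.toReal + ‖g x‖ ^ p.toReal) / 2 :=
    ((hi f).add (hi g)).div_const 2
  have i3 : Integrable fun x => C * ((‖f x‖ ^ p.toReal + ‖g x‖ ^ p.toReal) / 2 -
      ‖((1 / 2 : ℝ) • (f + g) : Lp F p (volume : Measure (E N))) x‖ ^ p.toReal) :=
    (i2.sub (hi _)).const_mul C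
  simp only [Lp_norm_rpow_eq_integral hp]
  rw [← integral_add (hi f) (hi g), ← integral_div, ← integral_const_mul,
    ← integral_sub i2 (hi _), ← integral_const_mul, ← integral_add i1 i3]
  refine integral_mono_ae (hi _) (i1.add i3) ?_
  filter_upwards [Lp.coeFn_sub f g, Lp.coeFn_smul (1 / 2 : ℝ) (f + g), Lp.coeFn_add f g]
    with x h1 h2 h3
  rw [h1, h2, Pi.smul_apply, h3]
  exact hC _ _

lemma Lp_norm_half_smul_add_rpow_le (hp1 : 1 < p) (hp : p ≠ ⊤)
    (f g : Lp F p (volume : Measure (E N))) :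
    ‖(1 / 2 : ℝ) • (f + g)‖ ^ p.toReal ≤ (‖f‖ ^ p.toReal + ‖g‖ ^ p.toReal) / 2 := by
  have hr : 1 < p.toReal := by
    simpa using (ENNReal.toReal_lt_toReal ENNReal.one_ne_top hp).2 hp1
  have h1 : ‖(1 / 2 : ℝ) • (f + g)‖ ≤ (1 / 2 : ℝ) • ‖f‖ + (1 / 2 : ℝ) • ‖g‖ := by
    rw [norm_smul, Real.norm_of_nonneg (by norm_num), smul_eq_mul, smul_eq_mul, ← mul_add]
    gcongr
    exact norm_add_le _ _
  have h2 := (convexOn_rpow hr.le).2 (norm_nonneg f) (norm_nonneg g)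
    (show (0 : ℝ) ≤ 1 / 2 by norm_num) (show (0 : ℝ) ≤ 1 / 2 by norm_num) (by norm_num)
  have h3 := Real.rpow_le_rpow (norm_nonneg _) h1 (by linarith : 0 ≤ p.toReal)
  simp only [smul_eq_mul] at h2 h3
  linarith

end Lp

end uniform_convexity

/-- In a Banach space with a uniformly convex gauge `Φ`, a decreasing sequence of nonempty closed
convex sets on which `Φ` is bounded has a common point: almost minimizers of `Φ` form a Cauchy
sequence. This plays the role of reflexivity. -/
lemma nonempty_iInter_of_uniformlyConvex {X : Type*} [NormedAddCommGroup X] [NormedSpace ℝ X]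
    [CompleteSpace X] {Φ : X → ℝ} (hΦ0 : ∀ x, 0 ≤ Φ x) {M : ℝ}
    (hΦ : ∀ ε > 0, ∃ δ > 0, ∀ x y, Φ x ≤ M → Φ y ≤ M →
      (Φ x + Φ y) / 2 - Φ ((1 / 2 : ℝ) • (x + y)) ≤ δ → ‖x - y‖ ≤ ε)
    {K : ℕ → Set X} (hanti : Antitone K) (hcl : ∀ k, IsClosed (K k)) (hco : ∀ k, Convex ℝ (K k))
    (hne : ∀ k, (K k).Nonempty) (hM : ∀ x ∈ K 0, Φ x ≤ M) : ∃ x, ∀ k, x ∈ K k := by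
  have hbdd : ∀ k, BddBelow (Φ '' K k) := fun k => ⟨0, by rintro _ ⟨x, -, rfl⟩; exact hΦ0 x⟩
  set m : ℕ → ℝ := fun k => sInf (Φ '' K k)
  have hmono : Monotone m := fun j k hjk =>
    csInf_le_csInf (hbdd j) ((hne k).image Φ) (Set.image_mono (hanti hjk))
  have hmM : ∀ k, m k ≤ M := by
    intro k
    obtain ⟨x, hx⟩ := hne k
    exact (csInf_le (hbdd k) ⟨x, hx, rfl⟩).trans (hM x (hanti (Nat.zero_le k) hx))
  have hlim : Tendsto m atTop (𝓝 (⨆ k, m k)) :=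
    tendsto_atTop_ciSup hmono ⟨M, by rintro _ ⟨k, rfl⟩; exact hmM k⟩
  have hle : ∀ k, m k ≤ ⨆ k, m k :=
    le_ciSup (⟨M, by rintro _ ⟨k, rfl⟩; exact hmM k⟩ : BddAbove (Set.range m))
  set L := ⨆ k, m k
  have hx : ∀ k : ℕ, ∃ x ∈ K k, Φ x < m k + 1 / ((k : ℝ) + 1) := by
    intro k
    obtain ⟨_, ⟨x, hx, rfl⟩, hlt⟩ := exists_lt_of_csInf_lt ((hne k).image Φ)
      (show m k < m k + 1 / ((k : ℝ) + 1) by have : (0 : ℝ) < 1 / ((k : ℝ) + 1) := by positivity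
                                             linarith)
    exact ⟨x, hx, hlt⟩
  choose x hxK hxΦ using hx
  have hcauchy : CauchySeq x := by
    rw [Metric.cauchySeq_iff']
    intro ε hε
    obtain ⟨δ, hδ, hU⟩ := hΦ (ε / 2) (half_pos hε)
    have h1 : ∀ᶠ k in atTop, L - δ / 2 < m k := hlim.eventually (lt_mem_nhds (by linarith))
    have h2 : ∀ᶠ k : ℕ in atTop, 1 / ((k : ℝ) + 1) < δ / 2 :=
      tendsto_one_div_add_atTop_nhds_zero_nat.eventually (gt_mem_nhds (half_pos hδ))
    obtain ⟨k, hk1, hk2⟩ := (h1.and h2).exists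
    refine ⟨k, fun j hj => ?_⟩
    rw [dist_eq_norm]
    refine lt_of_le_of_lt (hU _ _ (hM _ (hanti (Nat.zero_le _) (hxK j)))
      (hM _ (hanti (Nat.zero_le _) (hxK k))) ?_) (half_lt_self hε)
    have hmid : (1 / 2 : ℝ) • (x j + x k) ∈ K k := by
      rw [smul_add]
      exact hco k (hanti hj (hxK j)) (hxK k) (by norm_num) (by norm_num) (by norm_num)
    have h3 : m k ≤ Φ ((1 / 2 : ℝ) • (x j + x k)) := csInf_le (hbdd k) ⟨_, hmid, rfl⟩
    have h4 : 1 / ((j : ℝ) + 1) ≤ 1 / ((k : ℝ) + 1) := by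
      have : (k : ℝ) ≤ j := by exact_mod_cast hj
      gcongr
    linarith [hxΦ j, hxΦ k, hle j, hle k]
  obtain ⟨y, hy⟩ := cauchySeq_tendsto_of_complete hcauchy
  refine ⟨y, fun k => (hcl k).mem_of_tendsto hy ?_⟩
  filter_upwards [eventually_ge_atTop k] with j hj
  exact hanti hj (hxK j)

/-! ### Closedness of `W^{1,p}` and weak compactness -/

section sobolev

variable {N : ℕ} {p : ℝ≥0∞} [Fact (1 ≤ p)]

lemma continuous_integral_inner {F : Type*} [NormedAddCommGroup F] [InnerProductSpace ℝ F]
    {ψ : E N → F} (hψ : Continuous ψ) (hc : HasCompactSupport ψ) :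
    Continuous fun f : Lp F p (volume : Measure (E N)) => ∫ x, inner ℝ (f x) (ψ x) := by
  have hpq : ENNReal.HolderConjugate p (ENNReal.conjExponent p) :=
    ENNReal.HolderConjugate.conjExponent Fact.out
  have : Fact (1 ≤ ENNReal.conjExponent p) := ⟨ENNReal.HolderConjugate.one_le _ p⟩
  have hm : MemLp ψ (ENNReal.conjExponent p) (volume : Measure (E N)) :=
    hψ.memLp_of_hasCompactSupport hc
  have h1 : Continuous fun f : Lp F p (volume : Measure (E N)) =>
      (innerSL ℝ (E := F)).lpPairing volume p (ENNReal.conjExponent p) f (hm.toLp ψ) :=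
    ((innerSL ℝ (E := F)).lpPairing volume p (ENNReal.conjExponent p)).continuous.clm_apply
      continuous_const
  refine h1.congr fun f => ?_
  rw [ContinuousLinearMap.lpPairing_eq_integral]
  refine integral_congr_ae ?_
  filter_upwards [hm.coeFn_toLp] with x hx
  rw [hx]
  rfl

lemma inner_smul_single (a : E N) (c : ℝ) (i : Fin N) :
    inner ℝ a (c • EuclideanSpace.single i (1 : ℝ)) = a i * c := by
  rw [inner_smul_right, EuclideanSpace.inner_single_right]
  simp [mul_comm]

lemma locallyIntegrable_Lp {F : Type*} [NormedAddCommGroup F]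
    (f : Lp F p (volume : Measure (E N))) : LocallyIntegrable f volume :=
  (Lp.memLp f).locallyIntegrable Fact.out

lemma isClosed_W1p : IsClosed (W1p N p : Set (Lp ℝ p (volume : Measure (E N)) ×
    Lp (E N) p (volume : Measure (E N)))) := by
  have h : (W1p N p : Set (Lp ℝ p (volume : Measure (E N)) × Lp (E N) p (volume : Measure (E N)))) =
      ⋂ (φ : E N → ℝ) (_ : ContDiff ℝ ∞ φ) (_ : HasCompactSupport φ) (i : Fin N),
        {F | ∫ x, inner ℝ (F.1 x) (fderiv ℝ φ x (EuclideanSpace.single i 1)) =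
          - ∫ x, inner ℝ (F.2 x) (φ x • EuclideanSpace.single i (1 : ℝ))} := by
    ext F
    simp only [Set.mem_iInter, Set.mem_ofPred_eq, inner_smul_single, RCLike.inner_apply,
      conj_trivial]
    constructor
    · intro hF φ hφ hc i
      simpa only [mul_comm] using IsWeakGradient.parts (u := F.1) (g := F.2) hF φ hφ hc i
    · intro hF
      exact ⟨locallyIntegrable_Lp _, locallyIntegrable_Lp _, fun φ hφ hc i => by
        simpa only [mul_comm] using hF φ hφ hc i⟩
  rw [h]
  refine isClosed_iInter fun φ => isClosed_iInter fun hφ => isClosed_iInter fun hc =>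
    isClosed_iInter fun i => isClosed_eq ?_ ?_
  · exact (continuous_integral_inner (continuous_partial hφ i) (hc.fderiv_apply ℝ _)).comp
      continuous_fst
  · exact ((continuous_integral_inner (hφ.continuous.smul continuous_const) hc.smul_right).comp
      continuous_snd).neg

instance : CompleteSpace (W1p N p) := isClosed_W1p.completeSpace_coe

/-- The weak gradient is determined by the function. -/
lemma W1p.ext_fst {U V : W1p N p} (h : U.1.1 =ᵐ[volume] V.1.1) : U = V := by
  have h2 : U.1.2 = V.1.2 := by
    have hi : ∀ i : Fin N, ∀ᵐ x, U.1.2 x i = V.1.2 x i := by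
      intro i
      refine ae_eq_of_integral_contDiff_smul_eq
        (locallyIntegrable_coord (locallyIntegrable_Lp U.1.2) i)
        (locallyIntegrable_coord (locallyIntegrable_Lp V.1.2) i) fun φ hφ hc => ?_
      have hU := IsWeakGradient.parts (u := U.1.1) (g := U.1.2) U.2 φ hφ hc i
      have hV := IsWeakGradient.parts (u := V.1.1) (g := V.1.2) V.2 φ hφ hc i
      have e : ∫ x, U.1.1 x * fderiv ℝ φ x (EuclideanSpace.single i 1) =
          ∫ x, V.1.1 x * fderiv ℝ φ x (EuclideanSpace.single i 1) :=
        integral_congr_ae (h.mono fun x hx => by simp only [hx])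
      simp only [smul_eq_mul, mul_comm (φ _)]
      linarith
    refine Lp.ext ?_
    filter_upwards [ae_all_iff.2 hi] with x hx
    ext i
    exact hx i
  exact Subtype.ext (Prod.ext (Lp.ext h) h2)

/-- The uniformly convex gauge `‖u‖_p ^ p + ‖∇u‖_p ^ p` on `W^{1,p}`. -/
def W1p.gauge (U : W1p N p) : ℝ := ‖U.1.1‖ ^ p.toReal + ‖U.1.2‖ ^ p.toReal

/-- The norm of `W^{1,p}` is the maximum of the two norms. -/
lemma W1p.norm_le_iff {U : W1p N p} {ε : ℝ} : ‖U‖ ≤ ε ↔ ‖U.1.1‖ ≤ ε ∧ ‖U.1.2‖ ≤ ε :=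
  norm_prod_le_iff

omit [Fact (1 ≤ p)] in
lemma W1p.gauge_half_smul_add (U V : W1p N p) : W1p.gauge ((1 / 2 : ℝ) • (U + V)) =
    ‖(1 / 2 : ℝ) • (U.1.1 + V.1.1)‖ ^ p.toReal + ‖(1 / 2 : ℝ) • (U.1.2 + V.1.2)‖ ^ p.toReal := rfl

/-- Choice of constants in the uniform convexity estimate: with weight `e / (4 M)` on the norms and
`e / (2 (C₁ + C₂ + 1))` as the convexity defect, each of the two terms is at most `e / 2`. -/
lemma le_of_modulus_bound {e M C₁ C₂ x a d C : ℝ} (he : 0 < e) (hM : 1 ≤ M) (hC₁ : 0 ≤ C₁)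
    (hC₂ : 0 ≤ C₂) (hx : x ≤ e / (4 * M) * a + C * d) (ha : a ≤ 2 * M) (hC : 0 ≤ C)
    (hC' : C ≤ C₁ + C₂ + 1) (hd : d ≤ e / (2 * (C₁ + C₂ + 1))) : x ≤ e := by
  have s1 : e / (4 * M) * a ≤ e / 2 := by
    calc _ ≤ e / (4 * M) * (2 * M) := by gcongr
      _ = e / 2 := by field_simp; ring
  have s2 : C * d ≤ e / 2 := by
    calc C * d ≤ C * (e / (2 * (C₁ + C₂ + 1))) := by gcongr
      _ ≤ (C₁ + C₂ + 1) * (e / (2 * (C₁ + C₂ + 1))) := by gcongr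
      _ = e / 2 := by field_simp
  linarith

lemma W1p.exists_gauge_le (hp1 : 1 < p) (hp : p ≠ ⊤) (M ε : ℝ) (hε : 0 < ε) :
    ∃ δ > 0, ∀ U V : W1p N p, W1p.gauge U ≤ M → W1p.gauge V ≤ M →
      (W1p.gauge U + W1p.gauge V) / 2 - W1p.gauge ((1 / 2 : ℝ) • (U + V)) ≤ δ → ‖U - V‖ ≤ ε := by
  have hr : 0 < p.toReal := ENNReal.toReal_pos (zero_lt_one.trans hp1).ne' hp
  have he0 : 0 < ε ^ p.toReal := Real.rpow_pos_of_pos hε _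
  obtain ⟨M', hMM', hM'⟩ : ∃ M', M ≤ M' ∧ 1 ≤ M' := ⟨max M 1, le_max_left _ _, le_max_right _ _⟩
  have hη : 0 < ε ^ p.toReal / (4 * M') := by positivity
  obtain ⟨C₁, hC₁, h₁⟩ := exists_Lp_norm_sub_rpow_le (N := N) (F := ℝ) hp1 hp hη
  obtain ⟨C₂, hC₂, h₂⟩ := exists_Lp_norm_sub_rpow_le (N := N) (F := E N) hp1 hp hη
  refine ⟨ε ^ p.toReal / (2 * (C₁ + C₂ + 1)), by positivity, ?_⟩
  rintro ⟨⟨u, g⟩, hU⟩ ⟨⟨v, k⟩, hV⟩ hUM hVM hD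
  rw [W1p.gauge_half_smul_add] at hD
  simp only [W1p.gauge] at hUM hVM hD
  have d₁ := Lp_norm_half_smul_add_rpow_le hp1 hp u v
  have d₂ := Lp_norm_half_smul_add_rpow_le hp1 hp g k
  have n1 : 0 ≤ ‖u‖ ^ p.toReal := Real.rpow_nonneg (norm_nonneg _) _
  have n2 : 0 ≤ ‖g‖ ^ p.toReal := Real.rpow_nonneg (norm_nonneg _) _
  have n3 : 0 ≤ ‖v‖ ^ p.toReal := Real.rpow_nonneg (norm_nonneg _) _
  have n4 : 0 ≤ ‖k‖ ^ p.toReal := Real.rpow_nonneg (norm_nonneg _) _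
  refine W1p.norm_le_iff.2 ⟨?_, ?_⟩
  · change ‖u - v‖ ≤ ε
    rw [← Real.rpow_le_rpow_iff (norm_nonneg _) hε.le hr]
    exact le_of_modulus_bound he0 hM' hC₁ hC₂ (h₁ u v) (by linarith) hC₁ (by linarith)
      (by linarith)
  · change ‖g - k‖ ≤ ε
    rw [← Real.rpow_le_rpow_iff (norm_nonneg _) hε.le hr]
    exact le_of_modulus_bound he0 hM' hC₁ hC₂ (h₂ g k) (by linarith) hC₂ (by linarith)
      (by linarith)

/-- The elements of `W^{1,p}` with given bounds form a closed convex set. -/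
lemma W1p.isClosed_convex_bounded (A B : ℝ) :
    IsClosed {V : W1p N p | ‖V.1.1‖ ≤ A ∧ ‖V.1.2‖ ≤ B} ∧
    Convex ℝ {V : W1p N p | ‖V.1.1‖ ≤ A ∧ ‖V.1.2‖ ≤ B} := by
  constructor
  · have hc1 : Continuous fun V : W1p N p => V.1.1 := continuous_fst.comp continuous_subtype_val
    have hc2 : Continuous fun V : W1p N p => V.1.2 := continuous_snd.comp continuous_subtype_val
    exact (isClosed_le hc1.norm continuous_const).inter (isClosed_le hc2.norm continuous_const)
  · intro U hU V hV a b ha hb hab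
    have key : ∀ {G : Type _} [NormedAddCommGroup G] [NormedSpace ℝ G] {x y : G} {A : ℝ},
        ‖x‖ ≤ A → ‖y‖ ≤ A → ‖a • x + b • y‖ ≤ A := by
      intro G _ _ x y A hx hy
      have := convex_closedBall (0 : G) A (mem_closedBall_zero_iff.2 hx)
        (mem_closedBall_zero_iff.2 hy) ha hb hab
      exact mem_closedBall_zero_iff.1 this
    exact ⟨key hU.1 hV.1, key hU.2 hV.2⟩

omit [Fact (1 ≤ p)] in
/-- A convex combination of the `U n`, `n ≥ k`, is as close to `v` at a point as all these are. -/
lemma W1p.abs_sub_le_of_mem_convexHull {U : ℕ → W1p N p} (v : E N → ℝ) (k : ℕ) {Y : W1p N p}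
    (hY : Y ∈ convexHull ℝ (U '' Set.Ici k)) : ∀ᵐ x, ∀ ε : ℝ,
      (∀ n ≥ k, |(U n).1.1 x - v x| ≤ ε) → |Y.1.1 x - v x| ≤ ε := by
  refine convexHull_min (t := {Y : W1p N p | ∀ᵐ x, ∀ ε : ℝ,
    (∀ n ≥ k, |(U n).1.1 x - v x| ≤ ε) → |Y.1.1 x - v x| ≤ ε}) ?_ ?_ hY
  · rintro _ ⟨n, hn, rfl⟩
    exact Eventually.of_forall (f := ae volume) fun x ε h => h n hn
  · intro Y hY Z hZ a b ha hb hab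
    have e : (a • Y + b • Z).1.1 = a • Y.1.1 + b • Z.1.1 := rfl
    filter_upwards [hY, hZ, Lp.coeFn_add (a • Y.1.1) (b • Z.1.1), Lp.coeFn_smul a Y.1.1,
      Lp.coeFn_smul b Z.1.1] with x hYx hZx h1 h2 h3 ε h
    rw [e, h1, Pi.add_apply, h2, h3, Pi.smul_apply, Pi.smul_apply, smul_eq_mul, smul_eq_mul]
    have e2 : a * Y.1.1 x + b * Z.1.1 x - v x = a * (Y.1.1 x - v x) + b * (Z.1.1 x - v x) := by
      linear_combination (v x) * hab
    rw [e2]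
    calc _ ≤ |a * (Y.1.1 x - v x)| + |b * (Z.1.1 x - v x)| := abs_add_le _ _
      _ = a * |Y.1.1 x - v x| + b * |Z.1.1 x - v x| := by
          rw [abs_mul, abs_mul, abs_of_nonneg ha, abs_of_nonneg hb]
      _ ≤ a * ε + b * ε := by gcongr; exacts [hYx ε h, hZx ε h]
      _ = ε := by rw [← add_mul, hab, one_mul]

/-- Weak sequential compactness in `W^{1,p}`: the a.e. limit `v` of a bounded sequence is in
`W^{1,p}`, and it lies in the closed convex hull of each tail of the sequence. -/
theorem exists_W1p_of_ae_tendsto (hp1 : 1 < p) (hp : p ≠ ⊤) {U : ℕ → W1p N p} {A B : ℝ}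
    (hA : ∀ n, ‖(U n).1.1‖ ≤ A) (hB : ∀ n, ‖(U n).1.2‖ ≤ B) {v : E N → ℝ}
    (hv : ∀ᵐ x, Tendsto (fun n => (U n).1.1 x) atTop (𝓝 (v x))) :
    ∃ V : W1p N p, Represents V v ∧ ∀ k, V ∈ closure (convexHull ℝ (U '' Set.Ici k)) := by
  have hKS : ∀ V ∈ closure (convexHull ℝ (U '' Set.Ici 0)), ‖V.1.1‖ ≤ A ∧ ‖V.1.2‖ ≤ B := by
    have h := W1p.isClosed_convex_bounded (N := N) (p := p) A B
    refine fun V hV => closure_minimal (convexHull_min ?_ h.2) h.1 hV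
    rintro _ ⟨n, -, rfl⟩
    exact ⟨hA n, hB n⟩
  obtain ⟨V, hV⟩ := nonempty_iInter_of_uniformlyConvex (Φ := W1p.gauge (N := N) (p := p))
    (M := A ^ p.toReal + B ^ p.toReal)
    (K := fun k => closure (convexHull ℝ (U '' Set.Ici k)))
    (fun V => add_nonneg (Real.rpow_nonneg (norm_nonneg _) _) (Real.rpow_nonneg (norm_nonneg _) _))
    (W1p.exists_gauge_le hp1 hp _)
    (fun j k hjk => closure_mono (convexHull_mono (Set.image_mono (Set.Ici_subset_Ici.2 hjk))))
    (fun k => isClosed_closure) (fun k => (convex_convexHull ℝ _).closure)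
    (fun k => ⟨U k, subset_closure (subset_convexHull ℝ _ ⟨k, Set.self_mem_Ici, rfl⟩)⟩)
    (fun V hV => by
      have := hKS V hV
      exact add_le_add (Real.rpow_le_rpow (norm_nonneg _) this.1 ENNReal.toReal_nonneg)
        (Real.rpow_le_rpow (norm_nonneg _) this.2 ENNReal.toReal_nonneg))
  refine ⟨V, ?_, hV⟩
  have hY : ∀ k : ℕ, ∃ Y ∈ convexHull ℝ (U '' Set.Ici k), dist V Y < 1 / ((k : ℝ) + 1) :=
    fun k => Metric.mem_closure_iff.1 (hV k) _ (by positivity)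
  choose Y hYh hYd using hY
  have hYV : Tendsto Y atTop (𝓝 V) := by
    rw [tendsto_iff_dist_tendsto_zero]
    refine squeeze_zero (fun _ => dist_nonneg) (fun k => ?_)
      tendsto_one_div_add_atTop_nhds_zero_nat
    rw [dist_comm]
    exact (hYd k).le
  have hc1 : Continuous fun V : W1p N p => V.1.1 := continuous_fst.comp continuous_subtype_val
  have h1 : Tendsto (fun k => (Y k).1.1) atTop (𝓝 V.1.1) := (hc1.tendsto V).comp hYV
  obtain ⟨ns, hns, hlim⟩ := (tendstoInMeasure_of_tendsto_Lp h1).exists_seq_tendsto_ae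
  filter_upwards [hlim, hv,
    ae_all_iff.2 fun k => W1p.abs_sub_le_of_mem_convexHull v k (hYh k)] with x hx1 hx2 hx3
  refine tendsto_nhds_unique hx1 ?_
  rw [Metric.tendsto_atTop] at hx2 ⊢
  intro ε hε
  obtain ⟨k, hk⟩ := hx2 (ε / 2) (half_pos hε)
  refine ⟨k, fun j hj => ?_⟩
  rw [Real.dist_eq]
  refine lt_of_le_of_lt (hx3 (ns j) (ε / 2) fun n hn => ?_) (half_lt_self hε)
  exact (hk n (hj.trans ((hns.le_apply).trans hn))).le

end sobolev

/-! ### Polarization of Lipschitz functions -/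

section lipschitz

variable {N : ℕ}

lemma inner_gradient {f : E N → ℝ} (x v : E N) : inner ℝ (gradient f x) v = fderiv ℝ f x v := by
  rw [← toDual_gradient, InnerProductSpace.toDual_apply_apply]

lemma gradient_apply {f : E N → ℝ} (x : E N) (i : Fin N) :
    gradient f x i = fderiv ℝ f x (EuclideanSpace.single i 1) := by
  rw [← inner_gradient, EuclideanSpace.inner_single_right]
  simp

lemma enorm_gradient {f : E N → ℝ} (x : E N) : ‖gradient f x‖ₑ = ‖fderiv ℝ f x‖ₑ := by
  rw [← toDual_gradient, LinearIsometryEquiv.enorm_map]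

lemma measurable_gradient (f : E N → ℝ) : Measurable (gradient f) :=
  (InnerProductSpace.toDual ℝ (E N)).symm.continuous.measurable.comp (measurable_fderiv ℝ f)

lemma isWeakGradient_gradient {f : E N → ℝ} {C : ℝ≥0} (hf : LipschitzWith C f) :
    IsWeakGradient f (gradient f) where
  locInt := hf.continuous.locallyIntegrable
  locInt_grad := by
    have h : MemLp (gradient f) ⊤ (volume : Measure (E N)) :=
      memLp_top_of_bound (measurable_gradient f).aestronglyMeasurable C (.of_forall fun x => by
        have := norm_fderiv_le_of_lipschitz ℝ hf (x₀ := x)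
        rwa [← toDual_gradient, LinearIsometryEquiv.norm_map] at this)
    exact h.locallyIntegrable le_top
  parts φ hφ hc i := by
    obtain ⟨D, hD⟩ := ContDiff.lipschitzWith_of_hasCompactSupport hc hφ (by simp)
    have h1 := LipschitzWith.integral_lineDeriv_mul_eq (μ := volume) hf hD hc
      (EuclideanSpace.single i (1 : ℝ))
    have h2 : ∫ x, gradient f x i * φ x =
        ∫ x, lineDeriv ℝ f x (EuclideanSpace.single i (1 : ℝ)) * φ x := by
      refine integral_congr_ae ?_
      filter_upwards [hf.ae_differentiableAt (μ := volume)] with x hx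
      rw [hx.lineDeriv_eq_fderiv, gradient_apply]
    rw [h2, h1, ← integral_neg]
    refine integral_congr_ae (.of_forall fun x => ?_)
    have h3 : DifferentiableAt ℝ φ x := (hφ.differentiable (by simp)) x
    simp only [h3.lineDeriv_eq_fderiv, map_neg]
    ring

lemma lipschitzWith_polarize (H : HalfSpace N) {f : E N → ℝ} {C : ℝ≥0} (hf : LipschitzWith C f) :
    LipschitzWith C (polarize H f) := by
  refine LipschitzWith.of_dist_le_mul fun x y => ?_
  rw [Real.dist_eq]
  refine polarize_modulus H (δ := dist x y) (fun x' y' h => ?_) x y le_rfl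
  rw [← Real.dist_eq]
  exact (hf.dist_le_mul x' y').trans (by gcongr)

/-- Two functions that touch at a point have the same derivative there. -/
lemma fderiv_eq_of_le_of_eq {f g : E N → ℝ} {x : E N} (hf : DifferentiableAt ℝ f x)
    (hg : DifferentiableAt ℝ g x) (hx : f x = g x) (h : ∀ᶠ y in 𝓝 x, f y ≤ g y) :
    fderiv ℝ f x = fderiv ℝ g x := by
  have hmin : IsLocalMin (g - f) x := by
    filter_upwards [h] with y hy
    simp only [Pi.sub_apply, hx, sub_self]
    linarith
  have := hmin.fderiv_eq_zero
  rw [fderiv_sub hg hf, sub_eq_zero] at this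
  exact this.symm

lemma enorm_fderiv_comp_reflect_le (H : HalfSpace N) {f : E N → ℝ} {x : E N}
    (hf : DifferentiableAt ℝ f (H.reflect x)) :
    DifferentiableAt ℝ (fun y => f (H.reflect y)) x ∧
      ‖fderiv ℝ (fun y => f (H.reflect y)) x‖ₑ ≤ ‖fderiv ℝ f (H.reflect x)‖ₑ := by
  set R : E N →ₗᵢ[ℝ] E N := (ℝ ∙ H.normal)ᗮ.reflection.toLinearIsometry
  have h1 : HasFDerivAt H.reflect R.toContinuousLinearMap x := by
    have h := (R.toContinuousLinearMap.hasFDerivAt (x := x)).add_const ((2 * H.offset) • H.normal)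
    refine h.congr_of_eventuallyEq (.of_forall fun y => ?_)
    exact H.reflect_eq y
  have h2 := hf.hasFDerivAt.comp x h1
  refine ⟨h2.differentiableAt, ?_⟩
  change ‖fderiv ℝ (f ∘ H.reflect) x‖ₑ ≤ _
  rw [h2.fderiv, enorm_le_iff_norm_le]
  refine (ContinuousLinearMap.opNorm_comp_le _ _).trans ?_
  exact mul_le_of_le_one_right (norm_nonneg _) R.norm_toContinuousLinearMap_le

/-- At a point of differentiability in the interior of `H`, the gradients of `f^H` at `x` and
`σ_H x` are those of `f`, or of `f ∘ σ_H`: there `f^H` touches one of these functions from above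
at `x`, and from below at `σ_H x`. -/
lemma enorm_fderiv_polarize_le (H : HalfSpace N) {f : E N → ℝ} {x : E N}
    (hx : inner ℝ H.normal x < H.offset) (hf : DifferentiableAt ℝ f x)
    (hf' : DifferentiableAt ℝ f (H.reflect x)) (hg : DifferentiableAt ℝ (polarize H f) x)
    (hg' : DifferentiableAt ℝ (polarize H f) (H.reflect x)) :
    (‖fderiv ℝ (polarize H f) x‖ₑ ≤ ‖fderiv ℝ f x‖ₑ ∧
      ‖fderiv ℝ (polarize H f) (H.reflect x)‖ₑ ≤ ‖fderiv ℝ f (H.reflect x)‖ₑ) ∨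
    (‖fderiv ℝ (polarize H f) x‖ₑ ≤ ‖fderiv ℝ f (H.reflect x)‖ₑ ∧
      ‖fderiv ℝ (polarize H f) (H.reflect x)‖ₑ ≤ ‖fderiv ℝ f x‖ₑ) := by
  have n1 : ∀ᶠ y in 𝓝 x, inner ℝ H.normal y ≤ H.offset := by
    have : IsOpen {y : E N | inner ℝ H.normal y < H.offset} :=
      isOpen_lt (by fun_prop) continuous_const
    filter_upwards [this.mem_nhds hx] with y hy using le_of_lt hy
  have hx' : H.offset < inner ℝ H.normal (H.reflect x) := by
    rw [H.inner_reflect]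
    linarith
  have n2 : ∀ᶠ y in 𝓝 (H.reflect x), H.offset ≤ inner ℝ H.normal y := by
    have : IsOpen {y : E N | H.offset < inner ℝ H.normal y} :=
      isOpen_lt continuous_const (by fun_prop)
    filter_upwards [this.mem_nhds hx'] with y hy using le_of_lt hy
  rcases le_total (f (H.reflect x)) (f x) with h | h
  · left
    constructor
    · refine (congrArg _ (fderiv_eq_of_le_of_eq hf hg ?_ ?_).symm).le
      · rw [polarize_of_le H hx.le, max_eq_left h]
      · filter_upwards [n1] with y hy
        rw [polarize_of_le H hy]
        exact le_max_left _ _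
    · refine (congrArg _ (fderiv_eq_of_le_of_eq hg' hf' ?_ ?_)).le
      · rw [polarize_reflect_of_le H hx.le, min_eq_right h]
      · filter_upwards [n2] with y hy
        rw [polarize_of_ge H hy]
        exact min_le_left _ _
  · right
    constructor
    · obtain ⟨hd, hle⟩ := enorm_fderiv_comp_reflect_le H hf'
      refine (congrArg _ (fderiv_eq_of_le_of_eq hd hg ?_ ?_).symm).le.trans hle
      · rw [polarize_of_le H hx.le, max_eq_right h]
      · filter_upwards [n1] with y hy
        rw [polarize_of_le H hy]
        exact le_max_right _ _
    · have hf2 : DifferentiableAt ℝ f (H.reflect (H.reflect x)) := by rwa [H.reflect_reflect]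
      obtain ⟨hd, hle⟩ := enorm_fderiv_comp_reflect_le H hf2
      rw [H.reflect_reflect] at hle
      refine (congrArg _ (fderiv_eq_of_le_of_eq hg' hd ?_ ?_)).le.trans hle
      · rw [polarize_reflect_of_le H hx.le, min_eq_left h, H.reflect_reflect]
      · filter_upwards [n2] with y hy
        rw [polarize_of_ge H hy]
        exact min_le_right _ _

lemma ae_inner_normal_ne (H : HalfSpace N) : ∀ᵐ x : E N, inner ℝ H.normal x ≠ H.offset := by
  set s : AffineSubspace ℝ (E N) :=
    AffineSubspace.mk' (H.offset • H.normal) (LinearMap.ker (innerSL ℝ H.normal).toLinearMap)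
  have hmem : ∀ x, x ∈ s ↔ inner ℝ H.normal x = H.offset := by
    intro x
    simp only [s, AffineSubspace.mem_mk', vsub_eq_sub, LinearMap.mem_ker,
      ContinuousLinearMap.coe_coe, innerSL_apply_apply, inner_sub_right, inner_smul_right,
      real_inner_self_eq_norm_sq, H.norm_normal, sub_eq_zero]
    norm_num
  have hs : s ≠ ⊤ := by
    intro h
    have h1 : (H.offset + 1) • H.normal ∈ s := by rw [h]; exact AffineSubspace.mem_top _ _ _
    rw [hmem, inner_smul_right, real_inner_self_eq_norm_sq, H.norm_normal] at h1
    linarith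
  refine measure_mono_null ?_ (Measure.addHaar_affineSubspace volume s hs)
  intro x hx
  simp only [ne_eq, Set.mem_compl_iff, Set.mem_ofPred_eq, not_not] at hx
  exact (hmem x).2 hx

/-- Polarization does not increase the `L^p` norm of the gradient of a Lipschitz function. -/
lemma eLpNorm_gradient_polarize_le (H : HalfSpace N) {p : ℝ≥0∞} (hp1 : 1 ≤ p) (hp : p ≠ ⊤)
    {f : E N → ℝ} {C : ℝ≥0} (hf : LipschitzWith C f) :
    eLpNorm (gradient (polarize H f)) p volume ≤ eLpNorm (gradient f) p volume := by
  refine eLpNorm_le_of_lintegral_le hp1 hp ?_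
  refine H.lintegral_le_of_add_reflect_le ((measurable_gradient _).enorm.pow_const _).aemeasurable
    ((measurable_gradient _).enorm.pow_const _).aemeasurable ?_
  have df := hf.ae_differentiableAt (μ := volume)
  have dg := (lipschitzWith_polarize H hf).ae_differentiableAt (μ := volume)
  have hq := H.measurePreserving_reflect.quasiMeasurePreserving
  filter_upwards [df, hq.ae df, dg, hq.ae dg, ae_inner_normal_ne H] with x h1 h2 h3 h4 h5
  simp only [enorm_gradient]
  rcases lt_or_gt_of_ne h5 with h5 | h5
  · rcases enorm_fderiv_polarize_le H h5 h1 h2 h3 h4 with ⟨a, b⟩ | ⟨a, b⟩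
    · gcongr
    · rw [add_comm (‖fderiv ℝ f x‖ₑ ^ p.toReal)]
      gcongr
  · have h6 : inner ℝ H.normal (H.reflect x) < H.offset := by
      rw [H.inner_reflect]
      linarith
    rcases enorm_fderiv_polarize_le H h6 h2 (by rwa [H.reflect_reflect]) h4
      (by rwa [H.reflect_reflect]) with ⟨a, b⟩ | ⟨a, b⟩
    · rw [H.reflect_reflect] at b
      gcongr
    · rw [H.reflect_reflect] at a b
      rw [add_comm (‖fderiv ℝ f x‖ₑ ^ p.toReal)]
      gcongr

end lipschitz

/-! ### Mollification -/

section mollification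

open scoped Convolution

variable {N : ℕ} {F : Type*} [NormedAddCommGroup F] [NormedSpace ℝ F]

/-- Jensen's inequality for the probability measure with density `ρ`. -/
lemma enorm_convolution_rpow_le {p : ℝ≥0∞} (hp1 : 1 ≤ p) (hp : p ≠ ⊤) {ρ : E N → ℝ}
    (hρc : Continuous ρ) (hρ0 : ∀ x, 0 ≤ ρ x) (hρi : Integrable ρ volume) (hρ1 : ∫ x, ρ x = 1)
    {g : E N → F} (hg : StronglyMeasurable g) (x : E N) :
    ‖(ρ ⋆[ContinuousLinearMap.lsmul ℝ ℝ, volume] g) x‖ₑ ^ p.toReal ≤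
      ∫⁻ t, ENNReal.ofReal (ρ t) * ‖g (x - t)‖ₑ ^ p.toReal := by
  have hp0 : p ≠ 0 := (zero_lt_one.trans_le hp1).ne'
  have hr : 0 < p.toReal := ENNReal.toReal_pos hp0 hp
  have hmρ : Measurable fun t => ENNReal.ofReal (ρ t) := hρc.measurable.ennreal_ofReal
  set ν : Measure (E N) := volume.withDensity fun t => ENNReal.ofReal (ρ t)
  have hν : IsProbabilityMeasure ν := ⟨by
    rw [withDensity_apply _ MeasurableSet.univ, Measure.restrict_univ,
      ← ofReal_integral_eq_lintegral_ofReal hρi (.of_forall hρ0), hρ1, ENNReal.ofReal_one]⟩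
  have hgx : StronglyMeasurable fun t => g (x - t) :=
    hg.comp_measurable (measurable_const.sub measurable_id)
  have hm : ∀ s : ℝ, Measurable fun t => ‖g (x - t)‖ₑ ^ s := fun s => hgx.enorm.pow_const s
  have h1 : ‖(ρ ⋆[ContinuousLinearMap.lsmul ℝ ℝ, volume] g) x‖ₑ ≤
      eLpNorm (fun t => g (x - t)) 1 ν := by
    rw [eLpNorm_one_eq_lintegral_enorm, lintegral_withDensity_eq_lintegral_mul _ hmρ hgx.enorm]
    refine (enorm_integral_le_lintegral_enorm _).trans (le_of_eq ?_)
    refine lintegral_congr fun t => ?_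
    rw [ContinuousLinearMap.lsmul_apply, enorm_smul, Pi.mul_apply, Real.enorm_of_nonneg (hρ0 t)]
  have h2 := h1.trans (eLpNorm_le_eLpNorm_of_exponent_le hp1 hgx.aestronglyMeasurable)
  rw [eLpNorm_eq_lintegral_rpow_enorm_toReal hp0 hp,
    lintegral_withDensity_eq_lintegral_mul _ hmρ (hm _)] at h2
  have h3 := ENNReal.rpow_le_rpow h2 hr.le
  rw [← ENNReal.rpow_mul, one_div_mul_cancel hr.ne', ENNReal.rpow_one] at h3
  exact h3

/-- Averaging does not increase the `L^p` norm. -/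
lemma eLpNorm_convolution_le {p : ℝ≥0∞} (hp1 : 1 ≤ p) (hp : p ≠ ⊤) {ρ : E N → ℝ}
    (hρc : Continuous ρ) (hρ0 : ∀ x, 0 ≤ ρ x) (hρi : Integrable ρ volume) (hρ1 : ∫ x, ρ x = 1)
    {g : E N → F} (hg : StronglyMeasurable g) :
    eLpNorm (ρ ⋆[ContinuousLinearMap.lsmul ℝ ℝ, volume] g) p volume ≤ eLpNorm g p volume := by
  refine eLpNorm_le_of_lintegral_le hp1 hp ?_
  refine (lintegral_mono fun x => enorm_convolution_rpow_le hp1 hp hρc hρ0 hρi hρ1 hg x).trans ?_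
  have hmρ : Measurable fun t => ENNReal.ofReal (ρ t) := hρc.measurable.ennreal_ofReal
  have hm : Measurable (Function.uncurry fun x t : E N =>
      ENNReal.ofReal (ρ t) * ‖g (x - t)‖ₑ ^ p.toReal) :=
    (hmρ.comp measurable_snd).mul
      (((hg.enorm).comp (measurable_fst.sub measurable_snd)).pow_const _)
  rw [lintegral_lintegral_swap hm.aemeasurable]
  have h1 : ∀ t, ∫⁻ x, ENNReal.ofReal (ρ t) * ‖g (x - t)‖ₑ ^ p.toReal =
      ENNReal.ofReal (ρ t) * ∫⁻ x, ‖g x‖ₑ ^ p.toReal := by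
    intro t
    rw [lintegral_const_mul' _ _ ENNReal.ofReal_ne_top,
      lintegral_sub_right_eq_self (fun x => ‖g x‖ₑ ^ p.toReal) t]
  simp only [h1]
  rw [lintegral_mul_const _ hmρ, ← ofReal_integral_eq_lintegral_ofReal hρi (.of_forall hρ0), hρ1,
    ENNReal.ofReal_one, one_mul]

/-- The mollification of an `L^p` function is bounded; applied to a weak gradient, this makes the
mollified function Lipschitz. -/
lemma exists_enorm_convolution_le {p : ℝ≥0∞} (hp1 : 1 ≤ p) (hp : p ≠ ⊤) {ρ : E N → ℝ}
    (hρc : Continuous ρ) (hρs : HasCompactSupport ρ) (hρ0 : ∀ x, 0 ≤ ρ x) (hρ1 : ∫ x, ρ x = 1)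
    {g : E N → F} (hg : StronglyMeasurable g) (hgp : MemLp g p volume) :
    ∃ C : ℝ≥0, ∀ x, ‖(ρ ⋆[ContinuousLinearMap.lsmul ℝ ℝ, volume] g) x‖ₑ ≤ C := by
  have hp0 : p ≠ 0 := (zero_lt_one.trans_le hp1).ne'
  have hr : 0 < p.toReal := ENNReal.toReal_pos hp0 hp
  obtain ⟨K, hK⟩ := hρs.exists_bound_of_continuous hρc
  set I := ∫⁻ x, ‖g x‖ₑ ^ p.toReal
  have hI : I < ⊤ := lintegral_rpow_enorm_lt_top_of_eLpNorm_lt_top hp0 hp hgp.2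
  have hfin : (ENNReal.ofReal K * I) ^ p.toReal⁻¹ ≠ ⊤ :=
    ENNReal.rpow_ne_top_of_nonneg (by positivity) (ENNReal.mul_ne_top ENNReal.ofReal_ne_top hI.ne)
  refine ⟨((ENNReal.ofReal K * I) ^ p.toReal⁻¹).toNNReal, fun x => ?_⟩
  rw [ENNReal.coe_toNNReal hfin, ENNReal.le_rpow_inv_iff hr]
  refine (enorm_convolution_rpow_le hp1 hp hρc hρ0 (hρc.integrable_of_hasCompactSupport hρs) hρ1 hg
    x).trans ?_
  calc ∫⁻ t, ENNReal.ofReal (ρ t) * ‖g (x - t)‖ₑ ^ p.toReal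
      ≤ ∫⁻ t, ENNReal.ofReal K * ‖g (x - t)‖ₑ ^ p.toReal := by
        gcongr with t
        exact (le_abs_self _).trans (hK t)
    _ = ENNReal.ofReal K * I := by
        rw [lintegral_const_mul' _ _ ENNReal.ofReal_ne_top,
          lintegral_sub_left_eq_self (fun t => ‖g t‖ₑ ^ p.toReal) x]

/-- Mollification commutes with the weak gradient. -/
lemma gradient_convolution {u : E N → ℝ} {g : E N → E N} (h : IsWeakGradient u g) {ρ : E N → ℝ}
    (hρ : ContDiff ℝ ∞ ρ) (hρs : HasCompactSupport ρ) (x : E N) :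
    DifferentiableAt ℝ (ρ ⋆[ContinuousLinearMap.lsmul ℝ ℝ, volume] u) x ∧
    gradient (ρ ⋆[ContinuousLinearMap.lsmul ℝ ℝ, volume] u) x =
      (ρ ⋆[ContinuousLinearMap.lsmul ℝ ℝ, volume] g) x := by
  have hd := hρs.hasFDerivAt_convolution_left (ContinuousLinearMap.lsmul ℝ ℝ)
    (hρ.of_le (by simp)) h.locInt x
  refine ⟨hd.differentiableAt, ?_⟩
  have hdiff : Differentiable ℝ ρ := hρ.differentiable (by simp)
  ext i
  rw [gradient_apply, hd.fderiv, convolution_eq_swap, convolution_eq_swap]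
  have hint1 : Integrable (fun t => ((ContinuousLinearMap.lsmul ℝ ℝ).precompL (E N))
      (fderiv ℝ ρ (x - t)) (u t)) volume := by
    have := (hρs.fderiv ℝ).convolutionExists_left
      ((ContinuousLinearMap.lsmul ℝ ℝ : ℝ →L[ℝ] ℝ →L[ℝ] ℝ).precompL (E N))
      (hρ.continuous_fderiv (by simp)) h.locInt x
    exact this.integrable_swap
  have hint2 : Integrable (fun t => (ContinuousLinearMap.lsmul ℝ ℝ) (ρ (x - t)) (g t)) volume := by
    have := hρs.convolutionExists_left
      (ContinuousLinearMap.lsmul ℝ ℝ : ℝ →L[ℝ] E N →L[ℝ] E N) hρ.continuous h.locInt_grad x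
    exact this.integrable_swap
  rw [ContinuousLinearMap.integral_apply hint1]
  have hφ : ContDiff ℝ ∞ fun t => ρ (x - t) := hρ.comp (contDiff_const.sub contDiff_id)
  have hφs : HasCompactSupport fun t => ρ (x - t) :=
    hρs.comp_homeomorph (Homeomorph.subLeft x)
  have hparts := h.parts _ hφ hφs i
  have e1 : ∀ t, fderiv ℝ (fun t => ρ (x - t)) t (EuclideanSpace.single i 1) =
      - fderiv ℝ ρ (x - t) (EuclideanSpace.single i 1) := by
    intro t
    have h1 : HasFDerivAt (fun t : E N => x - t) (-(ContinuousLinearMap.id ℝ (E N))) t :=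
      (hasFDerivAt_id t).const_sub x
    have h2 := (hdiff (x - t)).hasFDerivAt.comp t h1
    have h3 : fderiv ℝ (fun t => ρ (x - t)) t = _ := h2.fderiv
    rw [h3]
    simp
  simp only [e1, mul_neg, integral_neg, neg_inj] at hparts
  have e2 : (∫ t, (ContinuousLinearMap.lsmul ℝ ℝ) (ρ (x - t)) (g t)) i =
      ∫ t, ((ContinuousLinearMap.lsmul ℝ ℝ) (ρ (x - t)) (g t)) i :=
    ((EuclideanSpace.proj (𝕜 := ℝ) i).integral_comp_comm hint2).symm
  rw [e2]
  calc _ = ∫ t, u t * fderiv ℝ ρ (x - t) (EuclideanSpace.single i 1) := by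
        refine integral_congr_ae (.of_forall fun t => ?_)
        simp [ContinuousLinearMap.precompL_apply, mul_comm]
    _ = ∫ t, g t i * ρ (x - t) := hparts
    _ = _ := by
        refine integral_congr_ae (.of_forall fun t => ?_)
        simp [mul_comm]

/-- Each `U` in `W^{1,p}` is the a.e. limit of Lipschitz functions whose norms, and the norms of
whose gradients, do not exceed those of `U`. -/
lemma exists_lipschitz_approx {p : ℝ≥0∞} [Fact (1 ≤ p)] (hp : p ≠ ⊤) (U : W1p N p) :
    ∃ f : ℕ → E N → ℝ, (∀ n, ∃ C : ℝ≥0, LipschitzWith C (f n)) ∧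
      (∀ n, eLpNorm (f n) p volume ≤ eLpNorm U.1.1 p volume) ∧
      (∀ n, eLpNorm (gradient (f n)) p volume ≤ eLpNorm U.1.2 p volume) ∧
      ∀ᵐ x, Tendsto (fun n => f n x) atTop (𝓝 (U.1.1 x)) := by
  have hp1 : 1 ≤ p := Fact.out
  have hpos : ∀ n : ℕ, (0 : ℝ) < 1 / ((n : ℝ) + 1) := fun n => by positivity
  let b : ℕ → ContDiffBump (0 : E N) := fun n =>
    ⟨1 / ((n : ℝ) + 1), 2 * (1 / ((n : ℝ) + 1)), hpos n, by linarith [hpos n]⟩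
  have hb0 : Tendsto (fun n => (b n).rOut) atTop (𝓝 0) := by
    have := (tendsto_one_div_add_atTop_nhds_zero_nat (𝕜 := ℝ)).const_mul 2
    rwa [mul_zero] at this
  set ρ : ℕ → E N → ℝ := fun n => (b n).normed volume
  have hρ : ∀ n, ContDiff ℝ ∞ (ρ n) := fun n => (b n).contDiff_normed
  have hρs : ∀ n, HasCompactSupport (ρ n) := fun n => (b n).hasCompactSupport_normed
  have hρ0 : ∀ n x, 0 ≤ ρ n x := fun n x => (b n).nonneg_normed x
  have hρ1 : ∀ n, ∫ x, ρ n x = 1 := fun n => (b n).integral_normed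
  have hρi : ∀ n, Integrable (ρ n) volume := fun n => (b n).integrable_normed
  have hgrad := fun n x => gradient_convolution (u := U.1.1) (g := U.1.2) U.2 (hρ n) (hρs n) x
  refine ⟨fun n => ρ n ⋆[ContinuousLinearMap.lsmul ℝ ℝ, volume] U.1.1, fun n => ?_, fun n => ?_,
    fun n => ?_, ?_⟩
  · obtain ⟨C, hC⟩ := exists_enorm_convolution_le hp1 hp (hρ n).continuous (hρs n) (hρ0 n) (hρ1 n)
      (Lp.stronglyMeasurable U.1.2) (Lp.memLp U.1.2)
    refine ⟨C, lipschitzWith_of_nnnorm_fderiv_le (𝕜 := ℝ) (fun x => (hgrad n x).1) fun x => ?_⟩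
    have h1 := hC x
    rw [← (hgrad n x).2, enorm_gradient] at h1
    exact_mod_cast h1
  · exact eLpNorm_convolution_le hp1 hp (hρ n).continuous (hρ0 n) (hρi n) (hρ1 n)
      (Lp.stronglyMeasurable U.1.1)
  · rw [funext fun x => (hgrad n x).2]
    exact eLpNorm_convolution_le hp1 hp (hρ n).continuous (hρ0 n) (hρi n) (hρ1 n)
      (Lp.stronglyMeasurable U.1.2)
  · exact ContDiffBump.ae_convolution_tendsto_right_of_locallyIntegrable (K := 2) hb0
      (.of_forall fun n => le_rfl) (locallyIntegrable_Lp U.1.1)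

/-- Polarization maps `W^{1,p}` to itself and increases neither norm. -/
theorem exists_W1p_polarize {p : ℝ≥0∞} [Fact (1 ≤ p)] (hp1 : 1 < p) (hp : p ≠ ⊤) (H : HalfSpace N)
    (U : W1p N p) : ∃ V : W1p N p, Represents V (polarize H U.1.1) ∧
      ‖V.1.1‖ ≤ ‖U.1.1‖ ∧ ‖V.1.2‖ ≤ ‖U.1.2‖ := by
  obtain ⟨f, hlip, hf, hg, hlim⟩ := exists_lipschitz_approx hp U
  choose C hC using hlip
  have hpl := fun n => lipschitzWith_polarize H (hC n)
  have hfp : ∀ n, eLpNorm (polarize H (f n)) p volume ≤ eLpNorm U.1.1 p volume := by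
    intro n
    have := eLpNorm_polarize_sub_le H hp1.le hp (hC n).continuous.measurable.aemeasurable
      (v := 0) measurable_zero.aemeasurable
    rw [polarize_zero, sub_zero, sub_zero] at this
    exact this.trans (hf n)
  have hgp : ∀ n, eLpNorm (gradient (polarize H (f n))) p volume ≤ eLpNorm U.1.2 p volume :=
    fun n => (eLpNorm_gradient_polarize_le H hp1.le hp (hC n)).trans (hg n)
  have m1 : ∀ n, MemLp (polarize H (f n)) p volume := fun n =>
    ⟨(hpl n).continuous.aestronglyMeasurable, (hfp n).trans_lt (Lp.memLp U.1.1).2⟩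
  have m2 : ∀ n, MemLp (gradient (polarize H (f n))) p volume := fun n =>
    ⟨(measurable_gradient _).aestronglyMeasurable, (hgp n).trans_lt (Lp.memLp U.1.2).2⟩
  let W : ℕ → W1p N p := fun n => ⟨((m1 n).toLp _, (m2 n).toLp _),
    (isWeakGradient_gradient (hpl n)).congr (m1 n).coeFn_toLp.symm (m2 n).coeFn_toLp.symm⟩
  have hW1 : ∀ n, ‖(W n).1.1‖ ≤ ‖U.1.1‖ := fun n => by
    change ‖(m1 n).toLp _‖ ≤ _
    rw [Lp.norm_toLp, Lp.norm_def]
    exact ENNReal.toReal_mono (Lp.memLp U.1.1).2.ne (hfp n)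
  have hW2 : ∀ n, ‖(W n).1.2‖ ≤ ‖U.1.2‖ := fun n => by
    change ‖(m2 n).toLp _‖ ≤ _
    rw [Lp.norm_toLp, Lp.norm_def]
    exact ENNReal.toReal_mono (Lp.memLp U.1.2).2.ne (hgp n)
  have hWlim : ∀ᵐ x, Tendsto (fun n => (W n).1.1 x) atTop (𝓝 (polarize H U.1.1 x)) := by
    filter_upwards [hlim, H.measurePreserving_reflect.quasiMeasurePreserving.ae hlim,
      ae_all_iff.2 fun n => (m1 n).coeFn_toLp] with x h1 h2 h3
    have h4 : Tendsto (fun n => polarize H (f n) x) atTop (𝓝 (polarize H U.1.1 x)) := by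
      rcases le_total (inner ℝ H.normal x) H.offset with h | h
      · simp only [polarize_of_le H h]
        exact h1.max h2
      · simp only [polarize_of_ge H h]
        exact h1.min h2
    exact h4.congr fun n => (h3 n).symm
  obtain ⟨V, hV, hmem⟩ := exists_W1p_of_ae_tendsto hp1 hp hW1 hW2 hWlim
  have hbd := W1p.isClosed_convex_bounded (N := N) (p := p) ‖U.1.1‖ ‖U.1.2‖
  refine ⟨V, hV, closure_minimal (convexHull_min ?_ hbd.2) hbd.1 (hmem 0)⟩
  rintro _ ⟨n, -, rfl⟩
  exact ⟨hW1 n, hW2 n⟩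

end mollification

/-! ### Weak convergence to the symmetrization -/

section weak

variable {N : ℕ} {p : ℝ≥0∞} [Fact (1 ≤ p)]

lemma eq_of_tendsto_of_mem_closure_convexHull {U : ℕ → W1p N p} {V : W1p N p}
    (hV : ∀ k, V ∈ closure (convexHull ℝ (U '' Set.Ici k))) (ℓ : W1p N p →L[ℝ] ℝ) {c : ℝ}
    (hc : Tendsto (fun n => ℓ (U n)) atTop (𝓝 c)) : ℓ V = c := by
  refine eq_of_forall_dist_le fun ε hε => ?_
  obtain ⟨k, hk⟩ := Metric.tendsto_atTop.1 hc ε hε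
  have h1 : closure (convexHull ℝ (U '' Set.Ici k)) ⊆ ℓ ⁻¹' Metric.closedBall c ε := by
    refine closure_minimal (convexHull_min ?_ ?_) (Metric.isClosed_closedBall.preimage ℓ.continuous)
    · rintro _ ⟨n, hn, rfl⟩
      exact (hk n hn).le
    · exact (convex_closedBall c ε).linear_preimage ℓ.toLinearMap
  exact h1 (hV k)

lemma exists_W1p_polarizeSeq (hp1 : 1 < p) (hp : p ≠ ⊤) (H : ℕ → HalfSpace N) {u : E N → ℝ}
    {U : W1p N p} (hU : Represents U u) (n : ℕ) : ∃ V : W1p N p,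
      Represents V (polarizeSeq H u n) ∧ ‖V.1.1‖ ≤ ‖U.1.1‖ ∧ ‖V.1.2‖ ≤ ‖U.1.2‖ := by
  refine polarizeSeq_induction (P := fun w => ∃ V : W1p N p, Represents V w ∧
    ‖V.1.1‖ ≤ ‖U.1.1‖ ∧ ‖V.1.2‖ ≤ ‖U.1.2‖) ?_ ⟨U, hU, le_rfl, le_rfl⟩ n
  rintro k w ⟨V, hV, h1, h2⟩
  obtain ⟨V', hV', h1', h2'⟩ := exists_W1p_polarize hp1 hp (H k) V
  exact ⟨V', EventuallyEq.trans hV' (polarize_congr_ae _ hV), h1'.trans h1, h2'.trans h2⟩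

/-- The iterated polarizations of `u` converge to `u^*` weakly in `W^{1,p}`: they are bounded
there and converge in `L^p`. -/
theorem weakTendsto_polarizeSeq (hN : 1 ≤ N) (hp1 : 1 < p) (hp : p ≠ ⊤) {H : ℕ → HalfSpace N}
    (hH : ∀ k, (0 : E N) ∈ interior (H k).carrier)
    (hdense : {K : HalfSpace N | (0 : E N) ∈ K.carrier} ⊆ closure (Set.range H))
    {u : E N → ℝ} (hu : MemW1pPos p u) :
    MemW1pPos p (schwarz u) ∧ WeakTendsto p (polarizeSeq H u) (schwarz u) := by
  obtain ⟨⟨U₀, hU₀⟩, hu0⟩ := hu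
  have hup : MemLp u p volume := (Lp.memLp U₀.1.1).ae_eq hU₀
  obtain ⟨hsp, hlim⟩ := tendsto_polarizeSeq hN hH hdense hp1.le hp hup hu0
  choose U hU hA hB using exists_W1p_polarizeSeq hp1 hp H hU₀
  -- Every subsequence has a further one that converges a.e., to which weak compactness applies.
  have key : ∀ ns : ℕ → ℕ, Tendsto ns atTop atTop → ∃ ms : ℕ → ℕ, StrictMono ms ∧
      ∀ᵐ x, Tendsto (fun n => (U (ns (ms n))).1.1 x) atTop (𝓝 (schwarz u x)) := by
    intro ns hns
    obtain ⟨ms, hms, hae⟩ := (tendstoInMeasure_of_tendsto_eLpNorm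
      (zero_lt_one.trans hp1).ne' (fun n => (memLp_polarizeSeq H hp1.le hp hup (ns n)).1) hsp.1
      (hlim.comp hns)).exists_seq_tendsto_ae
    refine ⟨ms, hms, ?_⟩
    filter_upwards [hae, ae_all_iff.2 hU] with x h1 h2
    simpa only [h2] using h1
  have hbdd : ∀ ℓ : W1p N p →L[ℝ] ℝ, ∀ n, ℓ (U n) ∈
      Metric.closedBall (0 : ℝ) (‖ℓ‖ * max ‖U₀.1.1‖ ‖U₀.1.2‖) := by
    intro ℓ n
    rw [mem_closedBall_zero_iff]
    refine (ℓ.le_opNorm _).trans ?_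
    gcongr
    exact W1p.norm_le_iff.2 ⟨(hA n).trans (le_max_left _ _), (hB n).trans (le_max_right _ _)⟩
  obtain ⟨ms₀, -, hms₀⟩ := key id tendsto_id
  obtain ⟨V, hV, -⟩ := exists_W1p_of_ae_tendsto hp1 hp (fun n => hA _) (fun n => hB _) hms₀
  refine ⟨⟨⟨V, hV⟩, .of_forall (schwarz_nonneg u)⟩, U, V, hU, hV, fun ℓ => ?_⟩
  refine tendsto_of_subseq_tendsto fun ns hns => ?_
  obtain ⟨c, -, ks, hks, hc⟩ := (isCompact_closedBall (0 : ℝ)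
    (‖ℓ‖ * max ‖U₀.1.1‖ ‖U₀.1.2‖)).tendsto_subseq (fun n => hbdd ℓ (ns n))
  obtain ⟨ms, hms, hae⟩ := key (ns ∘ ks) (hns.comp hks.tendsto_atTop)
  obtain ⟨V', hV', hmem⟩ := exists_W1p_of_ae_tendsto hp1 hp (U := fun n => U (ns (ks (ms n))))
    (fun n => hA _) (fun n => hB _) hae
  have hc' : Tendsto (fun n => ℓ (U (ns (ks (ms n))))) atTop (𝓝 c) := hc.comp hms.tendsto_atTop
  have hVV : V' = V := W1p.ext_fst (EventuallyEq.trans hV' (EventuallyEq.symm hV))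
  have := eq_of_tendsto_of_mem_closure_convexHull hmem ℓ hc'
  rw [hVV] at this
  exact ⟨ks ∘ ms, by rw [this]; exact hc'⟩

end weak

end PolyaSzego

end

open PolyaSzego in
theorem theorem3p1 (N : ℕ) (hN : 1 ≤ N) (p : ℝ≥0∞) [Fact (1 ≤ p)] (hp1 : 1 < p) (hp : p ≠ ⊤)
    (ϱ : ℝ≥0 × E N → ℝ) (hϱ : Measurable ϱ)
    (H : ℕ → HalfSpace N)
    (hH : ∀ k, (0 : E N) ∈ interior (H k).carrier)
    (hdense : {K : HalfSpace N | (0 : E N) ∈ K.carrier} ⊆ closure (Set.range H))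
    (u : E N → ℝ) (hu : MemW1pPos p u)
    (hJ : ∀ n, JExists ϱ (polarizeSeq H u n))
    (h1 : ⊥ < J ϱ u ∧ J ϱ u < ⊤)
    (h2 : liminf (fun n => J ϱ (polarizeSeq H u n)) atTop ≤ J ϱ u)
    (h3 : ∀ v : E N → ℝ, MemW1pPos p v → WeakTendsto p (polarizeSeq H u) v →
      JExists ϱ v ∧ J ϱ v ≤ liminf (fun n => J ϱ (polarizeSeq H u n)) atTop) :
    MemW1pPos p (schwarz u) ∧ JExists ϱ (schwarz u) ∧ J ϱ (schwarz u) ≤ J ϱ u := by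
  obtain ⟨hs, hw⟩ := weakTendsto_polarizeSeq hN hp1 hp hH hdense hu
  obtain ⟨hex, hle⟩ := h3 _ hs hw
  exact ⟨hs, hex, hle.trans h2⟩
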